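/- Fix $\beta>0$, let $M_\beta(x)=\frac{x-i\beta}{x+i\beta}$ and $T(\theta)=M_\beta^{-1}(e^{i\theta})$ for $\theta\in(0,2\pi)$, so that $T$ maps $(0,2\pi)$ onto $\mathbb R$. For a continuous $f:\mathbb R\to\mathbb C$ with $f(x)\to0$ as $|x|\to\infty$ let $F=f\circ T$ on $(0,2\pi)$, extended continuously and $2\pi$-periodically by $F(0)=0$. For real $s$ write $\hat F_k=\frac1{2\pi}\int_0^{2\pi}e^{-ik\theta}F(\theta)\,d\theta$ and $$\|F\|_{H^s(\mathbb T)}=\Big(\sum_{k\in\mathbb Z}(1+|k|)^{2s}|\hat F_k|^2\Big)^{1/2},$$ and let $H^s(\mathbb T)$ be the set of $F\in L^2(\mathbb T)$ for which this is finite. For an integer $n\ge1$ put $n_+=\lfloor n/2\rfloor$, $n_-=\lfloor (n-1)/2\rfloor$, $\theta_\ell=2\pi\ell/n$, $$\tilde F_k=\frac1n\sum_{\ell=0}^{n-1}e^{-ik\theta_\ell}F(\theta_\ell),\qquad \mathcal R_nf(x)=\sum_{k=-n_-}^{n_+}\tilde F_k\,M_\beta(x)^k ,$$ so that $\mathcal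 R_nf\circ T$ is the trigonometric interpolant of $F$ at the points $\theta_\ell$. Let $\mathcal Fh(k)=\int_{\mathbb R}e^{-ikx}h(x)\,dx$, understood as the Plancherel transform for $h\in L^2(\mathbb R)$ in (1), and for each individual $k$ as the principal value $\lim_{R\to\infty}\int_{-R}^Re^{-ikx}h(x)\,dx$ in (2) and (3). Suppose $F\in H^s(\mathbb T)$. All constants below may depend on $\beta$ and on the displayed subscripts, but not on $f$, $n$ or $k$. 1. If $\epsilon>0$, $s>1+\epsilon$ and $t\le s$ ($t$ real), then $f,\mathcal R_nf\in L^2(\mathbb R)$ and, for all $n\ge1$, $$\big\|(1+|\cdot|)^t\,\mathcal F(\mathcal R_nf-f)\big\|_{L^2(\mathbb R)}\le\big[C_{\epsilon,s}\,n^{1+\epsilon-s}+C_{s,t}\,n^{t-s}\big]\,\|F\|_{H^s(\mathbb T)} .$$ 2. If $\epsilon>0$ and $s>3/2+\epsilon$, then for all $n\ge1$ and all $k\in\mathbb R$ the principal values $\mathcal F\mathcal R_nf(k)$ and $\mathcal Ff(k)$ exist and $$|\mathcal F\mathcal R_nf(k)-\mathcal Ff(k)|\le C_{\epsilon,s}\,n^{3/2+\epsilon-s}\,\|F\|_{H^s(\mathbb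 T)} .$$ 3. If $j$ is an integer with $0<j\le s$, then for all $n\ge1$ and all real $k\ne0$ the principal values $\mathcal F\mathcal R_nf(k)$ and $\mathcal Ff(k)$ exist and $$|\mathcal F\mathcal R_nf(k)-\mathcal Ff(k)|\le C_{j,s}\,|k|^{-j}\,n^{j-s}\,\|F\|_{H^s(\mathbb T)} .$$ -/

import Mathlib

open MeasureTheory Filter Topology
open scoped FourierTransform

noncomputable section

namespace RationalFourier

/-! ### Periodic Sobolev spaces

A function on the periodic interval `[0, 2π)` is represented by a function `F : ℝ → ℂ`. -/

/-- The Fourier coefficient `(1 / 2π) ∫_0^{2π} e^{-ikθ} F(θ) dθ`. -/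
def fourierCoef (F : ℝ → ℂ) (k : ℤ) : ℂ :=
  (1 / (2 * (Real.pi : ℂ))) *
    ∫ θ in (0 : ℝ)..(2 * Real.pi), Complex.exp (-(Complex.I * k * θ)) * F θ

/-- The general term `(1 + |k|)^{2s} |F̂_k|²` of the squared periodic Sobolev norm. -/
def sobolevTerm (s : ℝ) (F : ℝ → ℂ) (k : ℤ) : ℝ :=
  (1 + |(k : ℝ)|) ^ (2 * s) * ‖fourierCoef F k‖ ^ 2

/-- `F ∈ H^s(𝕋)`: `F` is square integrable over a period and `∑ (1 + |k|)^{2s} |F̂_k|² < ∞`. -/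
def MemSobolevT (s : ℝ) (F : ℝ → ℂ) : Prop :=
  MemLp F 2 (volume.restrict (Set.Ico 0 (2 * Real.pi))) ∧ Summable (sobolevTerm s F)

/-- The norm of `H^s(𝕋)`. -/
def sobolevNormT (s : ℝ) (F : ℝ → ℂ) : ℝ :=
  Real.sqrt (∑' k : ℤ, sobolevTerm s F k)

/-! ### Trigonometric interpolation -/

/-- The discrete Fourier coefficient `(1/n) ∑_{ℓ < n} e^{-ikθ_ℓ} F(θ_ℓ)`, `θ_ℓ = 2πℓ/n`. -/
def discreteCoef (n : ℕ) (F : ℝ → ℂ) (k : ℤ) : ℂ :=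
  (1 / (n : ℂ)) * ∑ l ∈ Finset.range n,
    Complex.exp (-(Complex.I * k * ((2 * Real.pi * l / n : ℝ) : ℂ))) * F (2 * Real.pi * l / n)

/-- The indices `-n₋ ≤ k ≤ n₊` with `n₊ = ⌊n/2⌋` and `n₋ = ⌊(n-1)/2⌋` (`n ≥ 1`). -/
def modes (n : ℕ) : Finset ℤ :=
  Finset.Icc (-(((n - 1) / 2 : ℕ) : ℤ)) ((n / 2 : ℕ) : ℤ)

/-- The trigonometric interpolant `ℐ_n F`. -/
def trigInterp (n : ℕ) (F : ℝ → ℂ) (θ : ℝ) : ℂ :=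
  ∑ k ∈ modes n, discreteCoef n F k * Complex.exp (Complex.I * k * θ)

/-! ### The Möbius change of variables and rational interpolation -/

/-- `M_β(z) = (z - iβ) / (z + iβ)`. -/
def mobius (β : ℝ) (z : ℂ) : ℂ := (z - Complex.I * β) / (z + Complex.I * β)

/-- `M_β⁻¹(z) = (β / i) (z + 1) / (z - 1)`. -/
def mobiusInv (β : ℝ) (z : ℂ) : ℂ := (β / Complex.I) * ((z + 1) / (z - 1))

/-- `T(θ) = M_β⁻¹(e^{iθ})`, which is real for `θ ∉ 2πℤ` (see `changeVar_eq`). -/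
def changeVar (β θ : ℝ) : ℝ := (mobiusInv β (Complex.exp (Complex.I * θ))).re

open Classical in
/-- `F = f ∘ T`. The points `θ ∈ 2πℤ` correspond to `x = ±∞`; there `F` takes the value `0`, which
is its limit when `f` vanishes at infinity. -/
def pullback (β : ℝ) (f : ℝ → ℂ) (θ : ℝ) : ℂ :=
  if Complex.exp (Complex.I * θ) = 1 then 0 else f (changeVar β θ)

/-- The rational interpolant `ℛ_n f(x) = ∑_{k=-n₋}^{n₊} F̃_k M_β(x)^k`, that is
`ℛ_n f = (ℐ_n F) ∘ T⁻¹` (see `rationalInterp_changeVar`). -/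
def rationalInterp (β : ℝ) (n : ℕ) (f : ℝ → ℂ) (x : ℝ) : ℂ :=
  ∑ k ∈ modes n, discreteCoef n (pullback β f) k * mobius β x ^ k

theorem changeVar_eq (β θ : ℝ) :
    (changeVar β θ : ℂ) = mobiusInv β (Complex.exp (Complex.I * θ)) := by
  have hconj : (starRingEnd ℂ) (Complex.exp (Complex.I * θ))
      = (Complex.exp (Complex.I * θ))⁻¹ := by
    rw [← Complex.exp_conj, ← Complex.exp_neg]
    simp
  rw [changeVar, ← Complex.conj_eq_iff_re, mobiusInv]
  simp only [map_mul, map_div₀, map_add, map_sub, map_one, Complex.conj_ofReal, Complex.conj_I,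
    hconj]
  have h0 : Complex.exp (Complex.I * θ) ≠ 0 := Complex.exp_ne_zero _
  by_cases h1 : Complex.exp (Complex.I * θ) = 1
  · simp [h1]
  · have h2 : Complex.exp (Complex.I * θ) - 1 ≠ 0 := sub_ne_zero.mpr h1
    have h3 : 1 - Complex.exp (Complex.I * θ) ≠ 0 := sub_ne_zero.mpr (Ne.symm h1)
    have hI := Complex.I_ne_zero
    have h4 : (Complex.exp (Complex.I * θ))⁻¹ - 1
        = (1 - Complex.exp (Complex.I * θ)) / Complex.exp (Complex.I * θ) := by
      field_simp
    rw [h4]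
    field_simp
    ring

theorem mobius_changeVar {β : ℝ} (hβ : 0 < β) {θ : ℝ} (h : Complex.exp (Complex.I * θ) ≠ 1) :
    mobius β (changeVar β θ) = Complex.exp (Complex.I * θ) := by
  have hβ' : (β : ℂ) ≠ 0 := by exact_mod_cast hβ.ne'
  have h2 : Complex.exp (Complex.I * θ) - 1 ≠ 0 := sub_ne_zero.mpr h
  have hI := Complex.I_ne_zero
  rw [changeVar_eq, mobius, mobiusInv]
  set z := Complex.exp (Complex.I * θ)
  have e1 : (β / Complex.I) * ((z + 1) / (z - 1)) - Complex.I * β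
      = (β / Complex.I) * (2 * z / (z - 1)) := by
    field_simp
    rw [Complex.I_sq]
    ring
  have e2 : (β / Complex.I) * ((z + 1) / (z - 1)) + Complex.I * β
      = (β / Complex.I) * (2 / (z - 1)) := by
    field_simp
    rw [Complex.I_sq]
    ring
  rw [e1, e2]
  field_simp

theorem rationalInterp_changeVar {β : ℝ} (hβ : 0 < β) (n : ℕ) (f : ℝ → ℂ) {θ : ℝ}
    (h : Complex.exp (Complex.I * θ) ≠ 1) :
    rationalInterp β n f (changeVar β θ) = trigInterp n (pullback β f) θ := by
  simp only [rationalInterp, trigInterp, mobius_changeVar hβ h, ← Complex.exp_int_mul]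
  refine Finset.sum_congr rfl fun k _ => ?_
  congr 2
  ring

/-! ### Fourier transforms on the line, `ℱ h(k) = ∫ e^{-ikx} h(x) dx` -/

open Classical in
/-- The Fourier transform of `h ∈ L²(ℝ)`. Mathlib's transform has the kernel `e^{-2πiξx}`,
whence the rescaling of the argument. -/
def l2Fourier (h : ℝ → ℂ) (k : ℝ) : ℂ :=
  if hh : MemLp h 2 (volume : Measure ℝ) then
    (𝓕 (hh.toLp h) : Lp ℂ 2 (volume : Measure ℝ)) (k / (2 * Real.pi))
  else 0

/-- The norm of `H^t(ℝ)`, i.e. `‖(1 + |k|)^t ℱ h(k)‖_{L²(ℝ, dk)}`, for `h ∈ L²(ℝ)`. -/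
def sobolevNormR (t : ℝ) (h : ℝ → ℂ) : ENNReal :=
  eLpNorm (fun k : ℝ => (((1 + |k|) ^ t : ℝ) : ℂ) * l2Fourier h k) 2 volume

/-- The principal value integral `lim_{R → ∞} ∫_{-R}^R e^{-ikx} h(x) dx` exists and equals `a`. -/
def HasPVFourier (h : ℝ → ℂ) (k : ℝ) (a : ℂ) : Prop :=
  Tendsto (fun R : ℝ => ∫ x in (-R)..R, Complex.exp (-(Complex.I * k * x)) * h x) atTop (𝓝 a)

end RationalFourier

end

/-!
Since `F(0) = ∑ F̂_k = 0`, the function `f` is `∑ F̂_k (M_β^k - 1)`, and for the same reason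
`ℛ_n f - f` is `∑ e_k (M_β^k - 1)`, where `e` is the coefficient sequence of the error of the
trigonometric interpolant. Aliasing and truncation bound every weighted `ℓ²` norm of `e`, so it
remains to bound `∑ c_k (M_β^k - 1)` by weighted norms of `c`. Differentiation in `x` becomes
`(1 - cos θ) / β · d/dθ` on the circle, which acts on coefficients as a first order operator; this
gives the Sobolev norms of integer order and the factors `|k|⁻¹`, and real interpolation gives the
Sobolev norms of fractional order. The `L²` norm itself and the bound uniform in `k` are read off
from the single terms: `‖M_β^k - 1‖₂²` is a multiple of `|k|`, and the Fourier integrals of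
`M_β^k - 1` over `[-R, R]` are bounded by a multiple of `1 + |k|`.
-/

namespace RationalFourier

open scoped ENNReal

/-! ### Weighted sequences -/

/-- The Japanese bracket `⟨x⟩`, in the normalization `1 + |x|` of the Sobolev norms. -/
noncomputable def bracket {E : Type*} [ENorm E] (x : E) : ℝ≥0∞ := 1 + ‖x‖ₑ

/-- The squared norm `∑ ⟨k⟩^{2s} |c_k|²` of `H^s(𝕋)`, as a function of the Fourier coefficients. -/
noncomputable def weightedSq (s : ℝ) (c : ℤ → ℂ) : ℝ≥0∞ :=
  ∑' k, bracket k ^ (2 * s) * ‖c k‖ₑ ^ 2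

/-- The norm `∑ ⟨k⟩^p |c_k|` of the weighted Wiener algebra, as a function of the Fourier
coefficients. -/
noncomputable def absMoment (p : ℝ) (c : ℤ → ℂ) : ℝ≥0∞ :=
  ∑' k, bracket k ^ p * ‖c k‖ₑ

section Bracket

variable {E : Type*} [SeminormedAddCommGroup E] (x : E)

theorem one_le_bracket : 1 ≤ bracket x := le_self_add

theorem bracket_ne_zero : bracket x ≠ 0 := (one_pos.trans_le (one_le_bracket x)).ne'

theorem bracket_ne_top : bracket x ≠ ⊤ := ENNReal.add_ne_top.2 ⟨ENNReal.one_ne_top, enorm_ne_top⟩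

theorem bracket_rpow_ne_top (p : ℝ) : bracket x ^ p ≠ ⊤ :=
  ENNReal.rpow_ne_top_of_ne_zero (bracket_ne_zero x) (bracket_ne_top x)

theorem bracket_rpow_add (p q : ℝ) : bracket x ^ (p + q) = bracket x ^ p * bracket x ^ q :=
  ENNReal.rpow_add p q (bracket_ne_zero x) (bracket_ne_top x)

theorem bracket_rpow_mono {p q : ℝ} (h : p ≤ q) : bracket x ^ p ≤ bracket x ^ q :=
  ENNReal.rpow_le_rpow_of_exponent_le (one_le_bracket x) h

theorem bracket_rpow_sq (p : ℝ) : (bracket x ^ p) ^ 2 = bracket x ^ (2 * p) := by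
  rw [← ENNReal.rpow_mul_natCast, mul_comm p, Nat.cast_ofNat]

theorem bracket_eq_ofReal : bracket x = ENNReal.ofReal (1 + ‖x‖) := by
  rw [bracket, ENNReal.ofReal_add zero_le_one (norm_nonneg x), ENNReal.ofReal_one, ofReal_norm]

theorem ofReal_one_add_norm_rpow (p : ℝ) : ENNReal.ofReal ((1 + ‖x‖) ^ p) = bracket x ^ p := by
  rw [bracket_eq_ofReal, ENNReal.ofReal_rpow_of_pos (by positivity)]

end Bracket

theorem tsum_bracket_rpow_ne_top {r : ℝ} (hr : 1 < r) : ∑' k : ℤ, bracket k ^ (-r) ≠ ⊤ := by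
  have hnat : Summable fun n : ℕ => (1 + (n : ℝ)) ^ (-r) := by
    refine ((summable_nat_add_iff 1).2 (Real.summable_nat_rpow.2 (neg_lt_neg hr))).congr fun n => ?_
    rw [Nat.cast_add_one, add_comm]
  have hint : Summable fun k : ℤ => (1 + ‖k‖) ^ (-r) :=
    .of_nat_of_neg (by simpa using hnat) (by simpa using hnat)
  simp only [← ofReal_one_add_norm_rpow]
  exact hint.tsum_ofReal_ne_top

theorem lintegral_mul_sq_le {α : Type*} [MeasurableSpace α] (μ : Measure α) {f g : α → ℝ≥0∞}
    (hf : AEMeasurable f μ) (hg : AEMeasurable g μ) :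
    (∫⁻ a, f a * g a ∂μ) ^ 2 ≤ (∫⁻ a, f a ^ 2 ∂μ) * ∫⁻ a, g a ^ 2 ∂μ := by
  have holder := ENNReal.lintegral_mul_le_Lp_mul_Lq μ Real.HolderConjugate.two_two hf hg
  simp only [Pi.mul_apply, ENNReal.rpow_two] at holder
  calc (∫⁻ a, f a * g a ∂μ) ^ 2
      ≤ ((∫⁻ a, f a ^ 2 ∂μ) ^ (1 / 2 : ℝ) * (∫⁻ a, g a ^ 2 ∂μ) ^ (1 / 2 : ℝ)) ^ 2 := by gcongr
    _ = _ := by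
        rw [mul_pow, ← ENNReal.rpow_mul_natCast, ← ENNReal.rpow_mul_natCast]
        norm_num

theorem tsum_mul_sq_le {ι : Type*} (f g : ι → ℝ≥0∞) :
    (∑' i, f i * g i) ^ 2 ≤ (∑' i, f i ^ 2) * ∑' i, g i ^ 2 := by
  let _ : MeasurableSpace ι := ⊤
  simpa only [lintegral_count] using lintegral_mul_sq_le Measure.count
    (measurable_from_top (f := f)).aemeasurable (measurable_from_top (f := g)).aemeasurable

theorem enorm_add_sq_le {E : Type*} [NormedAddCommGroup E] (a b : E) :
    ‖a + b‖ₑ ^ 2 ≤ 2 * (‖a‖ₑ ^ 2 + ‖b‖ₑ ^ 2) := by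
  have h := ENNReal.rpow_add_le_mul_rpow_add_rpow ‖a‖ₑ ‖b‖ₑ one_le_two
  norm_num at h
  refine le_trans ?_ h
  gcongr
  exact enorm_add_le a b

theorem absMoment_sq_le (p σ : ℝ) (c : ℤ → ℂ) :
    absMoment p c ^ 2 ≤ (∑' k : ℤ, bracket k ^ (-(2 * (σ - p)))) * weightedSq σ c := by
  calc absMoment p c ^ 2
      = (∑' k : ℤ, bracket k ^ (p - σ) * (bracket k ^ σ * ‖c k‖ₑ)) ^ 2 := by
        simp only [absMoment, ← mul_assoc, ← bracket_rpow_add, sub_add_cancel]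
    _ ≤ _ := tsum_mul_sq_le _ _
    _ = _ := by
        simp only [weightedSq, mul_pow, bracket_rpow_sq, ← mul_neg, neg_sub]

theorem absMoment_ne_top {p σ : ℝ} (h : 1 < 2 * (σ - p)) {c : ℤ → ℂ} (hc : weightedSq σ c ≠ ⊤) :
    absMoment p c ≠ ⊤ := by
  have hsq : absMoment p c ^ 2 ≠ ⊤ :=
    ne_top_of_le_ne_top (ENNReal.mul_ne_top (tsum_bracket_rpow_ne_top h) hc)
      (absMoment_sq_le p σ c)
  exact fun htop => hsq (by simp [htop])

theorem weightedSq_mono_exponent {s t : ℝ} (h : s ≤ t) (c : ℤ → ℂ) :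
    weightedSq s c ≤ weightedSq t c :=
  ENNReal.tsum_le_tsum fun k => by
    gcongr ?_ * _
    exact bracket_rpow_mono k (by linarith)

theorem weightedSq_mono {s : ℝ} {c d : ℤ → ℂ} (h : ∀ k, ‖c k‖ₑ ≤ ‖d k‖ₑ) :
    weightedSq s c ≤ weightedSq s d :=
  ENNReal.tsum_le_tsum fun k => by
    gcongr
    exact h k

theorem absMoment_mono {p : ℝ} {c d : ℤ → ℂ} (h : ∀ k, ‖c k‖ₑ ≤ ‖d k‖ₑ) :
    absMoment p c ≤ absMoment p d :=
  ENNReal.tsum_le_tsum fun k => by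
    gcongr
    exact h k

theorem weightedSq_add_le (s : ℝ) (c d : ℤ → ℂ) :
    weightedSq s (c + d) ≤ 2 * (weightedSq s c + weightedSq s d) := by
  rw [weightedSq, weightedSq, weightedSq, ← ENNReal.tsum_add, ← ENNReal.tsum_mul_left]
  refine ENNReal.tsum_le_tsum fun k => ?_
  rw [← mul_add, mul_left_comm]
  gcongr
  exact enorm_add_sq_le _ _

theorem weightedSq_const_smul (s : ℝ) (a : ℂ) (c : ℤ → ℂ) :
    weightedSq s (a • c) = ‖a‖ₑ ^ 2 * weightedSq s c := by
  rw [weightedSq, weightedSq, ← ENNReal.tsum_mul_left]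
  refine tsum_congr fun k => ?_
  rw [Pi.smul_apply, enorm_smul]
  ring

theorem weightedSq_ne_top_of_finite (s : ℝ) {c : ℤ → ℂ} (hc : c.support.Finite) :
    weightedSq s c ≠ ⊤ := by
  rw [weightedSq, tsum_eq_sum (s := hc.toFinset) fun k hk => by simp_all]
  exact ENNReal.sum_ne_top.2 fun k _ =>
    ENNReal.mul_ne_top (bracket_rpow_ne_top k _) (ENNReal.pow_ne_top enorm_ne_top)

theorem absMoment_ne_top_of_finite (p : ℝ) {c : ℤ → ℂ} (hc : c.support.Finite) :
    absMoment p c ≠ ⊤ :=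
  absMoment_ne_top (σ := p + 1) (by linarith) (weightedSq_ne_top_of_finite _ hc)

theorem tsum_enorm_le_absMoment {p : ℝ} (hp : 0 ≤ p) (c : ℤ → ℂ) :
    ∑' k, ‖c k‖ₑ ≤ absMoment p c :=
  ENNReal.tsum_le_tsum fun k =>
    le_mul_of_one_le_left' (by simpa using bracket_rpow_mono k hp)

theorem summable_norm_of_absMoment {p : ℝ} (hp : 0 ≤ p) {c : ℤ → ℂ} (hc : absMoment p c ≠ ⊤) :
    Summable fun k => ‖c k‖ := by
  simpa using ENNReal.summable_toReal (ne_top_of_le_ne_top hc (tsum_enorm_le_absMoment hp c))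

theorem summable_norm_of_finite {c : ℤ → ℂ} (hc : c.support.Finite) : Summable fun k => ‖c k‖ :=
  summable_norm_of_absMoment le_rfl (absMoment_ne_top_of_finite 0 hc)

theorem summable_norm_of_weightedSq {s : ℝ} (hs : 1 / 2 < s) {c : ℤ → ℂ}
    (hc : weightedSq s c ≠ ⊤) : Summable fun k => ‖c k‖ :=
  summable_norm_of_absMoment le_rfl (absMoment_ne_top (by linarith) hc)

/-- Restriction of a sequence to a finite set of indices, extended by zero. -/
noncomputable def truncate (S : Finset ℤ) (c : ℤ → ℂ) : ℤ → ℂ := Set.indicator (S : Set ℤ) c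

theorem truncate_finite (S : Finset ℤ) (c : ℤ → ℂ) : (truncate S c).support.Finite :=
  S.finite_toSet.subset Set.support_indicator_subset

theorem enorm_truncate_le (S : Finset ℤ) (c : ℤ → ℂ) (k : ℤ) : ‖truncate S c k‖ₑ ≤ ‖c k‖ₑ :=
  enorm_indicator_le_enorm_self _ _

theorem enorm_sub_truncate_le (S : Finset ℤ) (c : ℤ → ℂ) (k : ℤ) :
    ‖(c - truncate S c) k‖ₑ ≤ ‖c k‖ₑ := by
  by_cases h : k ∈ S <;> simp [truncate, h]

theorem tendsto_tsum_sub_truncate {φ : ℤ → ℂ → ℝ≥0∞} (h0 : ∀ k, φ k 0 = 0) {c : ℤ → ℂ}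
    (hc : ∑' k, φ k (c k) ≠ ⊤) :
    Tendsto (fun S : Finset ℤ => ∑' k, φ k ((c - truncate S c) k)) atTop (𝓝 0) := by
  refine (ENNReal.tendsto_tsum_compl_atTop_zero hc).congr fun S => ?_
  refine (tsum_subtype {k : ℤ | k ∉ S} fun k => φ k (c k)).trans (tsum_congr fun k => ?_)
  by_cases h : k ∈ S <;> simp [truncate, h, h0]

theorem tendsto_weightedSq_sub_truncate {s : ℝ} {c : ℤ → ℂ} (hc : weightedSq s c ≠ ⊤) :
    Tendsto (fun S : Finset ℤ => weightedSq s (c - truncate S c)) atTop (𝓝 0) :=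
  tendsto_tsum_sub_truncate (φ := fun k z => bracket k ^ (2 * s) * ‖z‖ₑ ^ 2) (by simp) hc

theorem tendsto_absMoment_sub_truncate {p : ℝ} {c : ℤ → ℂ} (hc : absMoment p c ≠ ⊤) :
    Tendsto (fun S : Finset ℤ => absMoment p (c - truncate S c)) atTop (𝓝 0) :=
  tendsto_tsum_sub_truncate (φ := fun k z => bracket k ^ p * ‖z‖ₑ) (by simp) hc

/-! ### The Möbius map on the real line -/

theorem norm_zpow_sub_one_natAbs {z : ℂ} (hz : ‖z‖ = 1) (k : ℤ) :
    ‖z ^ k - 1‖ = ‖z ^ k.natAbs - 1‖ := by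
  have hz0 : z ≠ 0 := norm_ne_zero_iff.1 (by simp [hz])
  obtain h | h := Int.natAbs_eq k
  · rw [h, zpow_natCast, Int.natAbs_natCast]
  · rw [h, zpow_neg, zpow_natCast, Int.natAbs_neg, Int.natAbs_natCast,
      ← norm_neg (z ^ k.natAbs - 1), neg_sub]
    calc ‖(z ^ k.natAbs)⁻¹ - 1‖ = ‖(z ^ k.natAbs)⁻¹ * (1 - z ^ k.natAbs)‖ := by
          rw [mul_one_sub, inv_mul_cancel₀ (pow_ne_zero _ hz0)]
      _ = ‖1 - z ^ k.natAbs‖ := by rw [norm_mul, norm_inv, norm_pow, hz]; simp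

theorem norm_zpow_sub_one_le_two {z : ℂ} (hz : ‖z‖ = 1) (k : ℤ) : ‖z ^ k - 1‖ ≤ 2 := by
  calc ‖z ^ k - 1‖ ≤ ‖z ^ k‖ + ‖(1 : ℂ)‖ := norm_sub_le _ _
    _ = 2 := by rw [norm_zpow, hz, one_zpow, norm_one]; norm_num

/-- The density `2β / (x² + β²)` which the change of variables `e^{iθ} = M_β(x)` carries to `dθ`. -/
noncomputable def mobiusWeight (β x : ℝ) : ℝ := 2 * β / (x ^ 2 + β ^ 2)

section Mobius

variable {β : ℝ}

theorem add_I_mul_ne_zero (hβ : 0 < β) (x : ℝ) : (x : ℂ) + Complex.I * β ≠ 0 := fun h =>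
  hβ.ne' (by simpa using congrArg Complex.im h)

theorem mobiusWeight_pos (hβ : 0 < β) (x : ℝ) : 0 < mobiusWeight β x := by
  unfold mobiusWeight
  positivity

theorem mobiusWeight_le (hβ : 0 < β) (x : ℝ) : mobiusWeight β x ≤ 2 / β := by
  rw [mobiusWeight, div_le_div_iff₀ (by positivity) hβ]
  nlinarith [sq_nonneg x]

theorem mobiusWeight_continuous (hβ : 0 < β) : Continuous (mobiusWeight β) :=
  continuous_const.div (by fun_prop) fun x => by positivity

theorem norm_mobius (hβ : 0 < β) (x : ℝ) : ‖mobius β x‖ = 1 := by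
  have hconj : ‖(x : ℂ) - Complex.I * β‖ = ‖(x : ℂ) + Complex.I * β‖ := by
    rw [← Complex.norm_conj]
    simp
  rw [mobius, norm_div, hconj, div_self (norm_ne_zero_iff.2 (add_I_mul_ne_zero hβ x))]

theorem mobius_ne_zero (hβ : 0 < β) (x : ℝ) : mobius β x ≠ 0 :=
  norm_ne_zero_iff.1 (by simp [norm_mobius hβ])

theorem norm_mobius_zpow (hβ : 0 < β) (x : ℝ) (k : ℤ) : ‖mobius β x ^ k‖ = 1 := by
  rw [norm_zpow, norm_mobius hβ, one_zpow]

theorem one_sub_mobius (hβ : 0 < β) (x : ℝ) :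
    1 - mobius β x = 2 * Complex.I * β / (x + Complex.I * β) := by
  rw [mobius, eq_div_iff (add_I_mul_ne_zero hβ x), sub_mul,
    div_mul_cancel₀ _ (add_I_mul_ne_zero hβ x)]
  ring

theorem norm_one_sub_mobius_sq (hβ : 0 < β) (x : ℝ) :
    ‖1 - mobius β x‖ ^ 2 = 2 * β * mobiusWeight β x := by
  have hden : ‖(x : ℂ) + Complex.I * β‖ ^ 2 = x ^ 2 + β ^ 2 := by
    rw [← Complex.normSq_eq_norm_sq, Complex.normSq_apply]
    simp [sq]
  rw [one_sub_mobius hβ, norm_div, div_pow, hden, mobiusWeight]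
  simp [abs_of_pos hβ]
  ring

theorem two_mul_mobiusWeight_eq (hβ : 0 < β) (x : ℝ) :
    2 * β * (mobiusWeight β x : ℂ) = 2 - mobius β x - (mobius β x)⁻¹ := by
  have hinv : (starRingEnd ℂ) (mobius β x) = (mobius β x)⁻¹ :=
    (Complex.inv_eq_conj (norm_mobius hβ x)).symm
  have hsq : (2 * β * mobiusWeight β x : ℂ) = (1 - mobius β x) * (1 - (mobius β x)⁻¹) := by
    rw [← hinv, ← map_one (starRingEnd ℂ), ← map_sub, map_one, Complex.mul_conj']
    exact_mod_cast (norm_one_sub_mobius_sq hβ x).symm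
  rw [hsq, one_sub_mul, mul_one_sub, mul_inv_cancel₀ (mobius_ne_zero hβ x)]
  ring

theorem hasDerivAt_mobius (hβ : 0 < β) (x : ℝ) :
    HasDerivAt (fun x : ℝ => mobius β x) (Complex.I * mobiusWeight β x * mobius β x) x := by
  have hadd := add_I_mul_ne_zero hβ x
  have hprod : (x : ℂ) ^ 2 + (β : ℂ) ^ 2 = (x - Complex.I * β) * (x + Complex.I * β) := by
    linear_combination (β : ℂ) ^ 2 * Complex.I_sq
  have hsub : (x : ℂ) - Complex.I * β ≠ 0 := (div_ne_zero_iff.1 (mobius_ne_zero hβ x)).1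
  have hid : HasDerivAt (fun x : ℝ => (x : ℂ)) 1 x := Complex.ofRealCLM.hasDerivAt
  refine ((hid.sub_const (Complex.I * β)).div (hid.add_const (Complex.I * β)) hadd).congr_deriv ?_
  rw [mobius, mobiusWeight]
  push_cast
  rw [hprod]
  field_simp
  ring

theorem hasDerivAt_mobius_zpow (hβ : 0 < β) (k : ℤ) (x : ℝ) :
    HasDerivAt (fun x : ℝ => mobius β x ^ k)
      (Complex.I * k * mobiusWeight β x * mobius β x ^ k) x := by
  have hM := mobius_ne_zero hβ x
  refine ((hasDerivAt_zpow k _ (Or.inl hM)).comp x (hasDerivAt_mobius hβ x)).congr_deriv ?_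
  rw [zpow_sub_one₀ hM]
  field_simp

theorem mobius_zpow_continuous (hβ : 0 < β) (k : ℤ) : Continuous fun x : ℝ => mobius β x ^ k :=
  continuous_iff_continuousAt.2 fun x => (hasDerivAt_mobius_zpow hβ k x).continuousAt

theorem tendsto_mobius_zpow (hβ : 0 < β) (k : ℤ) :
    Tendsto (fun x : ℝ => mobius β x ^ k) (cocompact ℝ) (𝓝 1) := by
  have hden : Tendsto (fun x : ℝ => ‖(x : ℂ) + Complex.I * β‖) (cocompact ℝ) atTop :=
    tendsto_atTop_mono (fun x => by simpa using Complex.abs_re_le_norm (x + Complex.I * β))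
      (tendsto_norm_cocompact_atTop (E := ℝ))
  have hsub : Tendsto (fun x : ℝ => 1 - mobius β x) (cocompact ℝ) (𝓝 0) := by
    simp only [one_sub_mobius hβ, div_eq_mul_inv]
    rw [← mul_zero (2 * Complex.I * (β : ℂ))]
    exact (tendsto_inv₀_cobounded.comp (tendsto_norm_atTop_iff_cobounded.1 hden)).const_mul _
  have hM : Tendsto (fun x : ℝ => mobius β x) (cocompact ℝ) (𝓝 1) := by
    simpa using hsub.const_sub 1
  simpa using hM.zpow₀ k (Or.inl one_ne_zero)

theorem mobiusWeight_eq_comp_div (hβ : 0 < β) (x : ℝ) :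
    mobiusWeight β x = 2 / β * (1 + (x / β) ^ 2)⁻¹ := by
  rw [mobiusWeight]
  field_simp
  ring

theorem integrable_mobiusWeight (hβ : 0 < β) : Integrable (mobiusWeight β) := by
  rw [funext (mobiusWeight_eq_comp_div hβ)]
  exact (integrable_inv_one_add_sq.comp_div hβ.ne').const_mul _

theorem integral_mobiusWeight (hβ : 0 < β) : ∫ x, mobiusWeight β x = 2 * Real.pi := by
  simp only [mobiusWeight_eq_comp_div hβ]
  rw [integral_const_mul, Measure.integral_comp_div (fun x => (1 + x ^ 2)⁻¹) β,
    integral_univ_inv_one_add_sq, abs_of_pos hβ, smul_eq_mul]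
  field_simp

theorem lintegral_mobiusWeight (hβ : 0 < β) :
    ∫⁻ x, ENNReal.ofReal (mobiusWeight β x) = ENNReal.ofReal (2 * Real.pi) := by
  rw [← ofReal_integral_eq_lintegral_ofReal (integrable_mobiusWeight hβ)
    (.of_forall fun x => (mobiusWeight_pos hβ x).le), integral_mobiusWeight hβ]

theorem integrable_mobiusWeight_mul_zpow (hβ : 0 < β) (k : ℤ) :
    Integrable fun x : ℝ => (mobiusWeight β x : ℂ) * mobius β x ^ k :=
  (integrable_mobiusWeight hβ).ofReal.mul_bdd
    (mobius_zpow_continuous hβ k).aestronglyMeasurable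
    (.of_forall fun x => (norm_mobius_zpow hβ x k).le)

theorem integral_mobiusWeight_mul_zpow (hβ : 0 < β) (k : ℤ) :
    ∫ x : ℝ, (mobiusWeight β x : ℂ) * mobius β x ^ k = if k = 0 then 2 * (Real.pi : ℂ) else 0 := by
  split_ifs with hk
  · simp only [hk, zpow_zero, mul_one]
    rw [integral_complex_ofReal, integral_mobiusWeight hβ]
    push_cast
    rfl
  · have hk' : (k : ℂ) ≠ 0 := by exact_mod_cast hk
    have hderiv (x : ℝ) : HasDerivAt (fun x : ℝ => (Complex.I * k)⁻¹ * mobius β x ^ k)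
        ((mobiusWeight β x : ℂ) * mobius β x ^ k) x := by
      refine ((hasDerivAt_mobius_zpow hβ k x).const_mul (Complex.I * (k : ℂ))⁻¹).congr_deriv ?_
      field_simp [Complex.I_ne_zero]
    have hlim := (tendsto_mobius_zpow hβ k).const_mul (Complex.I * (k : ℂ))⁻¹
    rw [cocompact_eq_atBot_atTop, tendsto_sup] at hlim
    rw [integral_of_hasDerivAt_of_tendsto hderiv (integrable_mobiusWeight_mul_zpow hβ k)
      hlim.1 hlim.2, sub_self]

theorem mobiusWeight_mul_norm_sum_sq (hβ : 0 < β) (S : Finset ℤ) (a : ℤ → ℂ) (x : ℝ) :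
    ((mobiusWeight β x * ‖∑ k ∈ S, a k * mobius β x ^ k‖ ^ 2 : ℝ) : ℂ) =
      ∑ k ∈ S, ∑ l ∈ S, a k * (starRingEnd ℂ) (a l) *
        ((mobiusWeight β x : ℂ) * mobius β x ^ (k - l)) := by
  push_cast
  rw [← Complex.mul_conj', map_sum, Finset.sum_mul_sum, Finset.mul_sum]
  refine Finset.sum_congr rfl fun k _ => ?_
  rw [Finset.mul_sum]
  refine Finset.sum_congr rfl fun l _ => ?_
  rw [map_mul, map_zpow₀, ← Complex.inv_eq_conj (norm_mobius hβ x),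
    zpow_sub₀ (mobius_ne_zero hβ x), inv_zpow]
  ring

theorem integrable_mobiusWeight_mul_norm_sum_sq (hβ : 0 < β) (S : Finset ℤ) (a : ℤ → ℂ) :
    Integrable fun x : ℝ => mobiusWeight β x * ‖∑ k ∈ S, a k * mobius β x ^ k‖ ^ 2 := by
  have h : Integrable fun x : ℝ =>
      ((mobiusWeight β x * ‖∑ k ∈ S, a k * mobius β x ^ k‖ ^ 2 : ℝ) : ℂ) := by
    simp only [mobiusWeight_mul_norm_sum_sq hβ]
    exact integrable_finsetSum S fun k _ => integrable_finsetSum S fun l _ =>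
      (integrable_mobiusWeight_mul_zpow hβ (k - l)).const_mul _
  exact h.re

theorem integral_mobiusWeight_mul_norm_sum_sq (hβ : 0 < β) (S : Finset ℤ) (a : ℤ → ℂ) :
    ∫ x : ℝ, mobiusWeight β x * ‖∑ k ∈ S, a k * mobius β x ^ k‖ ^ 2 =
      2 * Real.pi * ∑ k ∈ S, ‖a k‖ ^ 2 := by
  have hint (k l : ℤ) : Integrable fun x : ℝ => a k * (starRingEnd ℂ) (a l) *
      ((mobiusWeight β x : ℂ) * mobius β x ^ (k - l)) :=
    (integrable_mobiusWeight_mul_zpow hβ (k - l)).const_mul _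
  rw [← Complex.ofReal_inj, ← integral_complex_ofReal]
  simp only [mobiusWeight_mul_norm_sum_sq hβ]
  rw [integral_finsetSum S fun k _ => integrable_finsetSum S fun l _ => hint k l]
  push_cast
  rw [Finset.mul_sum]
  refine Finset.sum_congr rfl fun k hk => ?_
  rw [integral_finsetSum S fun l _ => hint k l]
  simp only [integral_const_mul, integral_mobiusWeight_mul_zpow hβ, sub_eq_zero, mul_ite,
    mul_zero, Finset.sum_ite_eq, hk, if_true, Complex.mul_conj']
  ring

theorem lintegral_mobiusWeight_mul_enorm_sum_sq (hβ : 0 < β) (S : Finset ℤ) (a : ℤ → ℂ) :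
    ∫⁻ x : ℝ, ENNReal.ofReal (mobiusWeight β x) * ‖∑ k ∈ S, a k * mobius β x ^ k‖ₑ ^ 2 =
      ENNReal.ofReal (2 * Real.pi) * ∑ k ∈ S, ‖a k‖ₑ ^ 2 := by
  have h := ofReal_integral_eq_lintegral_ofReal (integrable_mobiusWeight_mul_norm_sum_sq hβ S a)
    (.of_forall fun x => mul_nonneg (mobiusWeight_pos hβ x).le (sq_nonneg _))
  rw [integral_mobiusWeight_mul_norm_sum_sq hβ, ENNReal.ofReal_mul (by positivity),
    ENNReal.ofReal_sum_of_nonneg (by simp)] at h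
  simpa only [ENNReal.ofReal_mul (mobiusWeight_pos hβ _).le, ENNReal.ofReal_pow (norm_nonneg _),
    ofReal_norm] using h.symm

theorem lintegral_enorm_mobius_pow_sub_one_sq (hβ : 0 < β) (n : ℕ) :
    ∫⁻ x : ℝ, ‖mobius β x ^ n - 1‖ₑ ^ 2 = ENNReal.ofReal (4 * Real.pi * β) * n := by
  have hgeom (x : ℝ) : ‖mobius β x ^ n - 1‖ₑ ^ 2 = ENNReal.ofReal (2 * β) *
      (ENNReal.ofReal (mobiusWeight β x) *
        ‖∑ k ∈ (Finset.range n).map Nat.castEmbedding, (1 : ℂ) * mobius β x ^ (k : ℤ)‖ₑ ^ 2) := by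
    rw [← mul_assoc, ← ENNReal.ofReal_mul (by positivity), ← norm_one_sub_mobius_sq hβ,
      norm_sub_rev, ENNReal.ofReal_pow (norm_nonneg _), ofReal_norm, ← mul_pow, ← enorm_mul,
      ← mul_geom_sum, Finset.sum_map]
    simp only [Nat.castEmbedding_apply, one_mul, zpow_natCast]
  simp only [hgeom]
  rw [lintegral_const_mul' _ _ ENNReal.ofReal_ne_top,
    lintegral_mobiusWeight_mul_enorm_sum_sq hβ, ← mul_assoc, ← ENNReal.ofReal_mul (by positivity)]
  simp only [enorm_one, one_pow, Finset.sum_const, Finset.card_map, Finset.card_range, nsmul_one]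
  ring_nf

theorem lintegral_enorm_mobius_zpow_sub_one_sq (hβ : 0 < β) (k : ℤ) :
    ∫⁻ x : ℝ, ‖mobius β x ^ k - 1‖ₑ ^ 2 = ENNReal.ofReal (4 * Real.pi * β) * ‖k‖ₑ := by
  have habs (x : ℝ) : ‖mobius β x ^ k - 1‖ₑ = ‖mobius β x ^ k.natAbs - 1‖ₑ := by
    rw [← ofReal_norm, norm_zpow_sub_one_natAbs (norm_mobius hβ x), ofReal_norm]
  simp only [habs]
  rw [lintegral_enorm_mobius_pow_sub_one_sq hβ, ← ofReal_norm k, Int.norm_eq_abs, ← Int.cast_abs,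
    ← Nat.cast_natAbs, ENNReal.ofReal_natCast]

end Mobius

/-! ### Series in `M_β^k - 1` -/

/-- The function `∑ c_k (M_β(x)^k - 1)`: the pullback to the line of the Fourier series with
coefficients `c`, normalized to vanish at infinity. -/
noncomputable def mobiusSeries (β : ℝ) (c : ℤ → ℂ) (x : ℝ) : ℂ :=
  ∑' k : ℤ, c k * (mobius β x ^ k - 1)

theorem lintegral_tsum_sq_le {α ι : Type*} [MeasurableSpace α] [Countable ι] {μ : Measure α}
    {f : ι → α → ℝ≥0∞} (hf : ∀ i, Measurable (f i)) {b : ι → ℝ≥0∞}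
    (hb : ∀ i, ∫⁻ a, f i a ^ 2 ∂μ ≤ b i ^ 2) :
    ∫⁻ a, (∑' i, f i a) ^ 2 ∂μ ≤ (∑' i, b i) ^ 2 := by
  have cross (i j : ι) : ∫⁻ a, f i a * f j a ∂μ ≤ b i * b j := by
    refine (ENNReal.pow_le_pow_left_iff two_ne_zero).1 ?_
    rw [mul_pow]
    exact (lintegral_mul_sq_le μ (hf i).aemeasurable (hf j).aemeasurable).trans
      (mul_le_mul' (hb i) (hb j))
  simp only [sq, ← ENNReal.tsum_mul_left, ← ENNReal.tsum_mul_right]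
  rw [lintegral_tsum fun i => by fun_prop]
  refine ENNReal.tsum_le_tsum fun i => ?_
  rw [lintegral_tsum fun j => by fun_prop]
  exact ENNReal.tsum_le_tsum fun j => cross j i

section Series

variable {β : ℝ} (hβ : 0 < β)
include hβ

theorem norm_mul_mobius_zpow_sub_one_le (c : ℤ → ℂ) (k : ℤ) (x : ℝ) :
    ‖c k * (mobius β x ^ k - 1)‖ ≤ ‖c k‖ * 2 := by
  rw [norm_mul]
  gcongr
  exact norm_zpow_sub_one_le_two (norm_mobius hβ x) k

theorem summable_mobiusSeries {c : ℤ → ℂ} (hc : Summable fun k => ‖c k‖) (x : ℝ) :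
    Summable fun k : ℤ => c k * (mobius β x ^ k - 1) :=
  .of_norm_bounded (hc.mul_right 2) fun k => norm_mul_mobius_zpow_sub_one_le hβ c k x

theorem mobiusSeries_sub {c d : ℤ → ℂ} (hc : Summable fun k => ‖c k‖)
    (hd : Summable fun k => ‖d k‖) (x : ℝ) :
    mobiusSeries β (c - d) x = mobiusSeries β c x - mobiusSeries β d x := by
  simp only [mobiusSeries, Pi.sub_apply, sub_mul]
  exact (summable_mobiusSeries hβ hc x).tsum_sub (summable_mobiusSeries hβ hd x)

theorem mobiusSeries_continuous {c : ℤ → ℂ} (hc : Summable fun k => ‖c k‖) :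
    Continuous (mobiusSeries β c) :=
  continuous_tsum
    (fun k => continuous_const.mul ((mobius_zpow_continuous hβ k).sub continuous_const))
    (hc.mul_right 2) (norm_mul_mobius_zpow_sub_one_le hβ c)

theorem lintegral_mobiusSeries_sq_le (c : ℤ → ℂ) :
    ∫⁻ x : ℝ, ‖mobiusSeries β c x‖ₑ ^ 2 ≤
      ENNReal.ofReal (4 * Real.pi * β) * absMoment (1 / 2) c ^ 2 := by
  set A := ENNReal.ofReal (4 * Real.pi * β)
  have sq_rpow_half (a : ℝ≥0∞) : (a ^ (1 / 2 : ℝ)) ^ 2 = a := by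
    rw [← ENNReal.rpow_mul_natCast]
    norm_num
  have term_le (k : ℤ) : ∫⁻ x : ℝ, ‖c k * (mobius β x ^ k - 1)‖ₑ ^ 2 ≤
      (A ^ (1 / 2 : ℝ) * (bracket k ^ (1 / 2 : ℝ) * ‖c k‖ₑ)) ^ 2 := by
    simp only [enorm_mul, mul_pow, sq_rpow_half]
    rw [lintegral_const_mul' _ _ (ENNReal.pow_ne_top enorm_ne_top),
      lintegral_enorm_mobius_zpow_sub_one_sq hβ, mul_comm, mul_assoc]
    gcongr
    exact le_add_self
  calc ∫⁻ x : ℝ, ‖mobiusSeries β c x‖ₑ ^ 2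
      ≤ ∫⁻ x : ℝ, (∑' k, ‖c k * (mobius β x ^ k - 1)‖ₑ) ^ 2 := by
        gcongr
        exact enorm_tsum_le_tsum_enorm
    _ ≤ (∑' k, A ^ (1 / 2 : ℝ) * (bracket k ^ (1 / 2 : ℝ) * ‖c k‖ₑ)) ^ 2 :=
        lintegral_tsum_sq_le (fun k => (continuous_const.mul
          ((mobius_zpow_continuous hβ k).sub continuous_const)).enorm.measurable) term_le
    _ = _ := by rw [ENNReal.tsum_mul_left, mul_pow, sq_rpow_half, absMoment]

end Series

/-! ### Differentiation of the series -/

/-- The action on coefficients of the derivative of `∑ c_k (M_β^k - 1)`. On the circle it is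
`(1 - cos θ) / β` times differentiation in `θ`, whence the three terms. -/
noncomputable def derivCoef (β : ℝ) (c : ℤ → ℂ) (m : ℤ) : ℂ :=
  Complex.I / (2 * β) * (2 * (m * c m) - (m - 1 : ℤ) * c (m - 1) - (m + 1 : ℤ) * c (m + 1))

theorem bracket_add_le_mul {E : Type*} [NormedAddCommGroup E] (x y : E) :
    bracket (x + y) ≤ bracket x * bracket y :=
  calc 1 + ‖x + y‖ₑ ≤ 1 + (‖x‖ₑ + ‖y‖ₑ) := by
        gcongr
        exact enorm_add_le x y
    _ ≤ 1 + (‖x‖ₑ + ‖y‖ₑ) + ‖x‖ₑ * ‖y‖ₑ := le_self_add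
    _ = (1 + ‖x‖ₑ) * (1 + ‖y‖ₑ) := by ring

theorem weightedSq_shift_le {s : ℝ} (hs : 0 ≤ s) (c : ℤ → ℂ) (a : ℤ) :
    weightedSq s (fun m => c (m + a)) ≤ bracket a ^ (2 * s) * weightedSq s c := by
  rw [weightedSq, weightedSq, ← ENNReal.tsum_mul_left, ← (Equiv.addRight a).tsum_eq
    fun k : ℤ => bracket a ^ (2 * s) * (bracket k ^ (2 * s) * ‖c k‖ₑ ^ 2)]
  refine ENNReal.tsum_le_tsum fun m => ?_
  rw [← mul_assoc, Equiv.coe_addRight, ← ENNReal.mul_rpow_of_nonneg _ _ (by positivity)]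
  gcongr
  calc bracket m = bracket (-a + (m + a)) := by congr 1; ring
    _ ≤ bracket (-a) * bracket (m + a) := bracket_add_le_mul _ _
    _ = bracket a * bracket (m + a) := by rw [bracket, enorm_neg, ← bracket]

theorem weightedSq_intCast_mul_le (s : ℝ) (c : ℤ → ℂ) :
    weightedSq s (fun k => k * c k) ≤ weightedSq (s + 1) c := by
  refine ENNReal.tsum_le_tsum fun k => ?_
  have hk : ‖(k : ℂ)‖ₑ = ‖k‖ₑ := by
    rw [← ofReal_norm, ← ofReal_norm, Complex.norm_intCast, Int.norm_eq_abs]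
  rw [enorm_mul, mul_pow, ← mul_assoc, mul_add 2 s, bracket_rpow_add, mul_one, ENNReal.rpow_two, hk]
  gcongr
  exact le_add_self

theorem exists_weightedSq_derivCoef_le (β : ℝ) {s : ℝ} (hs : 0 ≤ s) :
    ∃ C : ℝ≥0∞, C ≠ ⊤ ∧ ∀ c, weightedSq s (derivCoef β c) ≤ C * weightedSq (s + 1) c := by
  set A := bracket (1 : ℤ) ^ (2 * s)
  have hA : A ≠ ⊤ := bracket_rpow_ne_top 1 (2 * s)
  refine ⟨‖Complex.I / (2 * β)‖ₑ ^ 2 * (2 * (‖(2 : ℂ)‖ₑ ^ 2 + 2 * (A + A))), by finiteness,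
    fun c => ?_⟩
  set e : ℤ → ℂ := fun k => k * c k
  have he : weightedSq s e ≤ weightedSq (s + 1) c := weightedSq_intCast_mul_le s c
  have shift (a : ℤ) (ha : bracket a = bracket (1 : ℤ)) :
      weightedSq s ((-1 : ℂ) • fun m => e (m + a)) ≤ A * weightedSq (s + 1) c := by
    rw [weightedSq_const_smul, enorm_neg, enorm_one, one_pow, one_mul]
    refine (weightedSq_shift_le hs e a).trans ?_
    rw [ha]
    gcongr
  have decomp : derivCoef β c = (Complex.I / (2 * β)) •
      ((2 : ℂ) • e + ((-1 : ℂ) • (fun m => e (m + -1)) + (-1 : ℂ) • fun m => e (m + 1))) := by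
    funext m
    simp only [derivCoef, e, Pi.add_apply, Pi.smul_apply, smul_eq_mul]
    push_cast
    ring_nf
  calc weightedSq s (derivCoef β c)
      ≤ ‖Complex.I / (2 * β)‖ₑ ^ 2 * (2 * (‖(2 : ℂ)‖ₑ ^ 2 * weightedSq (s + 1) c +
          2 * (A * weightedSq (s + 1) c + A * weightedSq (s + 1) c))) := by
        rw [decomp, weightedSq_const_smul]
        gcongr
        refine (weightedSq_add_le _ _ _).trans ?_
        rw [weightedSq_const_smul]
        gcongr
        refine (weightedSq_add_le _ _ _).trans ?_
        gcongr
        · exact shift (-1) (by simp [bracket])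
        · exact shift 1 rfl
    _ = _ := by ring

theorem derivCoef_finite (β : ℝ) {c : ℤ → ℂ} (hc : c.support.Finite) :
    (derivCoef β c).support.Finite := by
  refine ((hc.union (hc.image (· + 1))).union (hc.image (· - 1))).subset fun m => ?_
  contrapose!
  intro hm
  simp only [Set.mem_union, Set.mem_image, Function.mem_support, not_or, not_exists, not_and,
    not_not] at hm
  have h_pred : c (m - 1) = 0 := by_contra fun h => hm.1.2 _ h (by ring)
  have h_succ : c (m + 1) = 0 := by_contra fun h => hm.2 _ h (by ring)
  simp [derivCoef, hm.1.1, h_pred, h_succ]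

theorem mobiusSeries_eq_sum (β : ℝ) {c : ℤ → ℂ} (hc : c.support.Finite) :
    mobiusSeries β c = fun x : ℝ => ∑ k ∈ hc.toFinset, c k * (mobius β x ^ k - 1) :=
  funext fun _ => tsum_eq_sum fun k hk => by
    simp [Function.notMem_support.1 (mt hc.mem_toFinset.2 hk)]

theorem sum_enorm_intCast_mul_sq_le (c : ℤ → ℂ) (S : Finset ℤ) :
    ∑ k ∈ S, ‖(k : ℂ) * c k‖ₑ ^ 2 ≤ weightedSq 1 c :=
  calc ∑ k ∈ S, ‖(k : ℂ) * c k‖ₑ ^ 2 ≤ ∑' k : ℤ, ‖(k : ℂ) * c k‖ₑ ^ 2 := ENNReal.sum_le_tsum S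
    _ = weightedSq 0 (fun k => k * c k) := by simp [weightedSq]
    _ ≤ weightedSq 1 c := by simpa using weightedSq_intCast_mul_le 0 c

section Derivative

variable {β : ℝ} (hβ : 0 < β) {c : ℤ → ℂ} (hc : c.support.Finite)
include hβ

theorem mobiusSeries_derivCoef (x : ℝ) :
    mobiusSeries β (derivCoef β c) x =
      Complex.I * mobiusWeight β x * ∑ k ∈ hc.toFinset, k * c k * mobius β x ^ k := by
  have hβ' : (2 * β : ℂ) ≠ 0 := by exact_mod_cast (mul_pos two_pos hβ).ne'
  set e : ℤ → ℂ := fun k => k * c k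
  set g : ℤ → ℂ := fun k => mobius β x ^ k - 1
  have hasSum_shift (a : ℤ) :
      HasSum (fun m => e (m + a) * g m) (∑ k ∈ hc.toFinset, e k * g (k - a)) := by
    rw [← (Equiv.subRight a).hasSum_iff]
    simp only [Function.comp_def, Equiv.subRight_apply, sub_add_cancel]
    exact hasSum_sum_of_ne_finset_zero fun k hk => by simp_all [e]
  have hsum := ((((hasSum_shift 0).mul_left 2).sub (hasSum_shift (-1))).sub
    (hasSum_shift 1)).mul_left (Complex.I / (2 * β))
  calc mobiusSeries β (derivCoef β c) x
      = ∑' m, Complex.I / (2 * β) * (2 * (e (m + 0) * g m) - e (m + -1) * g m - e (m + 1) * g m) :=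
        tsum_congr fun m => by simp only [derivCoef, e, g, add_zero, ← sub_eq_add_neg]; ring
    _ = ∑ k ∈ hc.toFinset, Complex.I / (2 * β) * (2 * β * mobiusWeight β x) *
          (k * c k * mobius β x ^ k) := by
        rw [hsum.tsum_eq, Finset.mul_sum, ← Finset.sum_sub_distrib, ← Finset.sum_sub_distrib,
          Finset.mul_sum]
        refine Finset.sum_congr rfl fun k _ => ?_
        simp only [e, g, sub_zero, sub_neg_eq_add, zpow_add_one₀ (mobius_ne_zero hβ x),
          zpow_sub_one₀ (mobius_ne_zero hβ x), two_mul_mobiusWeight_eq hβ]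
        ring
    _ = _ := by rw [← Finset.mul_sum, ← mul_assoc, div_mul_cancel₀ _ hβ']

include hc

theorem hasDerivAt_mobiusSeries (x : ℝ) :
    HasDerivAt (mobiusSeries β c) (mobiusSeries β (derivCoef β c) x) x := by
  rw [mobiusSeries_eq_sum β hc, mobiusSeries_derivCoef hβ hc, Finset.mul_sum]
  refine (HasDerivAt.fun_sum fun k _ =>
    ((hasDerivAt_mobius_zpow hβ k x).sub_const 1).const_mul (c k)).congr_deriv ?_
  exact Finset.sum_congr rfl fun k _ => by ring

theorem tendsto_mobiusSeries : Tendsto (mobiusSeries β c) (cocompact ℝ) (𝓝 0) := by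
  rw [mobiusSeries_eq_sum β hc]
  simpa using tendsto_finsetSum hc.toFinset fun k _ =>
    ((tendsto_mobius_zpow hβ k).sub_const 1).const_mul (c k)

theorem enorm_mobiusSeries_derivCoef (x : ℝ) :
    ‖mobiusSeries β (derivCoef β c) x‖ₑ = ENNReal.ofReal (mobiusWeight β x) *
      ‖∑ k ∈ hc.toFinset, k * c k * mobius β x ^ k‖ₑ := by
  rw [mobiusSeries_derivCoef hβ hc, enorm_mul, enorm_mul, ← ofReal_norm Complex.I, Complex.norm_I,
    ENNReal.ofReal_one, one_mul, ← ofReal_norm, Complex.norm_real,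
    Real.norm_of_nonneg (mobiusWeight_pos hβ x).le]

theorem lintegral_mobiusSeries_derivCoef_sq_le :
    ∫⁻ x, ‖mobiusSeries β (derivCoef β c) x‖ₑ ^ 2 ≤
      ENNReal.ofReal (4 * Real.pi / β) * weightedSq 1 c := by
  set P : ℝ → ℂ := fun x => ∑ k ∈ hc.toFinset, k * c k * mobius β x ^ k
  calc ∫⁻ x, ‖mobiusSeries β (derivCoef β c) x‖ₑ ^ 2
      ≤ ∫⁻ x : ℝ, ENNReal.ofReal (2 / β) * (ENNReal.ofReal (mobiusWeight β x) * ‖P x‖ₑ ^ 2) := by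
        refine lintegral_mono fun x => ?_
        rw [enorm_mobiusSeries_derivCoef hβ hc, mul_pow, sq (ENNReal.ofReal _), mul_assoc]
        gcongr
        exact mobiusWeight_le hβ x
    _ = ENNReal.ofReal (4 * Real.pi / β) * ∑ k ∈ hc.toFinset, ‖(k : ℂ) * c k‖ₑ ^ 2 := by
        rw [lintegral_const_mul' _ _ ENNReal.ofReal_ne_top,
          lintegral_mobiusWeight_mul_enorm_sum_sq hβ, ← mul_assoc,
          ← ENNReal.ofReal_mul (by positivity)]
        congr 2
        ring
    _ ≤ _ := by
        gcongr
        exact sum_enorm_intCast_mul_sq_le c _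

theorem sq_lintegral_mobiusSeries_derivCoef_le :
    (∫⁻ x, ‖mobiusSeries β (derivCoef β c) x‖ₑ) ^ 2 ≤
      ENNReal.ofReal (2 * Real.pi) ^ 2 * weightedSq 1 c := by
  set P : ℝ → ℂ := fun x => ∑ k ∈ hc.toFinset, k * c k * mobius β x ^ k
  have hP : Continuous P := continuous_finsetSum _ fun k _ =>
    continuous_const.mul (mobius_zpow_continuous hβ k)
  set μ : Measure ℝ := volume.withDensity fun x => ENNReal.ofReal (mobiusWeight β x)
  have hw : Measurable fun x => ENNReal.ofReal (mobiusWeight β x) :=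
    (mobiusWeight_continuous hβ).measurable.ennreal_ofReal
  have integral_eq {f : ℝ → ℝ≥0∞} (hf : Measurable f) :
      ∫⁻ x, f x ∂μ = ∫⁻ x, ENNReal.ofReal (mobiusWeight β x) * f x :=
    lintegral_withDensity_eq_lintegral_mul _ hw hf
  have cauchy := lintegral_mul_sq_le μ (aemeasurable_const (b := 1)) hP.enorm.aemeasurable
  simp only [one_mul, one_pow, lintegral_const, integral_eq hP.enorm.measurable,
    integral_eq (hP.enorm.measurable.pow_const 2)] at cauchy
  rw [lintegral_mobiusWeight_mul_enorm_sum_sq hβ, withDensity_apply _ .univ, Measure.restrict_univ,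
    lintegral_mobiusWeight hβ, ← mul_assoc, ← sq] at cauchy
  simp only [enorm_mobiusSeries_derivCoef hβ hc]
  refine cauchy.trans ?_
  gcongr
  exact sum_enorm_intCast_mul_sq_le c _

end Derivative

/-! ### Principal values -/

/-- The truncated Fourier integral `∫_{-R}^R e^{-iξx} h(x) dx`, whose limit as `R → ∞` is the
principal value. -/
noncomputable def partialFourier (h : ℝ → ℂ) (ξ R : ℝ) : ℂ :=
  ∫ x in (-R)..R, Complex.exp (-(Complex.I * ξ * x)) * h x

section PartialFourier

theorem norm_exp_neg_I_mul (ξ x : ℝ) : ‖Complex.exp (-(Complex.I * ξ * x))‖ = 1 := by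
  rw [Complex.norm_exp]
  simp

theorem enorm_exp_neg_I_mul (ξ x : ℝ) : ‖Complex.exp (-(Complex.I * ξ * x))‖ₑ = 1 := by
  rw [← ofReal_norm, norm_exp_neg_I_mul, ENNReal.ofReal_one]

theorem continuous_exp_neg_I_mul (ξ : ℝ) :
    Continuous fun x : ℝ => Complex.exp (-(Complex.I * ξ * x)) := by fun_prop

theorem intervalIntegrable_exp_neg_I_mul_mul {h : ℝ → ℂ} (hh : Continuous h) (ξ a b : ℝ) :
    IntervalIntegrable (fun x : ℝ => Complex.exp (-(Complex.I * ξ * x)) * h x) volume a b :=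
  ((continuous_exp_neg_I_mul ξ).mul hh).intervalIntegrable a b

theorem HasPVFourier.unique {h : ℝ → ℂ} {ξ : ℝ} {a b : ℂ} (ha : HasPVFourier h ξ a)
    (hb : HasPVFourier h ξ b) : a = b :=
  tendsto_nhds_unique ha hb

theorem partialFourier_sub {g h : ℝ → ℂ} (hg : Continuous g) (hh : Continuous h) (ξ R : ℝ) :
    partialFourier (fun x => g x - h x) ξ R = partialFourier g ξ R - partialFourier h ξ R := by
  simp only [partialFourier, mul_sub]
  exact intervalIntegral.integral_sub (intervalIntegrable_exp_neg_I_mul_mul hg ξ _ _)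
    (intervalIntegrable_exp_neg_I_mul_mul hh ξ _ _)

theorem HasPVFourier.sub {g h : ℝ → ℂ} (hg : Continuous g) (hh : Continuous h) {ξ : ℝ} {a b : ℂ}
    (ha : HasPVFourier g ξ a) (hb : HasPVFourier h ξ b) :
    HasPVFourier (fun x => g x - h x) ξ (a - b) :=
  (Tendsto.sub ha hb).congr fun R => (partialFourier_sub hg hh ξ R).symm

theorem exists_hasPVFourier_of_integrable {h : ℝ → ℂ} (hh : Integrable h) (ξ : ℝ) :
    ∃ a, HasPVFourier h ξ a :=
  ⟨_, intervalIntegral_tendsto_integral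
    (hh.bdd_mul (continuous_exp_neg_I_mul ξ).aestronglyMeasurable
      (.of_forall fun x => (norm_exp_neg_I_mul ξ x).le))
    tendsto_neg_atTop_atBot tendsto_id⟩

theorem enorm_partialFourier_le_lintegral (h : ℝ → ℂ) (ξ R : ℝ) :
    ‖partialFourier h ξ R‖ₑ ≤ ∫⁻ x, ‖h x‖ₑ := by
  rw [partialFourier, ← ofReal_norm, intervalIntegral.norm_intervalIntegral_eq, ofReal_norm]
  refine (enorm_integral_le_lintegral_enorm _).trans ?_
  simp only [enorm_mul, enorm_exp_neg_I_mul, one_mul]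
  exact setLIntegral_le_lintegral _ _

theorem hasDerivAt_exp_neg_I_mul {ξ : ℝ} (hξ : ξ ≠ 0) (x : ℝ) :
    HasDerivAt (fun x : ℝ => Complex.I / ξ * Complex.exp (-(Complex.I * ξ * x)))
      (Complex.exp (-(Complex.I * ξ * x))) x := by
  have hξ' : (ξ : ℂ) ≠ 0 := Complex.ofReal_ne_zero.2 hξ
  have hlin : HasDerivAt (fun x : ℝ => -(Complex.I * ξ * x)) (-(Complex.I * ξ * 1)) x :=
    ((Complex.ofRealCLM.hasDerivAt (x := x)).const_mul (Complex.I * ξ)).neg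
  refine (hlin.cexp.const_mul (Complex.I / ξ)).congr_deriv ?_
  field_simp
  linear_combination -Complex.I_sq

theorem enorm_mul_enorm_I_div_mul {ξ : ℝ} (hξ : ξ ≠ 0) (z : ℂ) :
    ‖ξ‖ₑ * ‖Complex.I / ξ * z‖ₑ = ‖z‖ₑ := by
  simp only [← ofReal_norm, ← ENNReal.ofReal_mul (norm_nonneg _), norm_mul, norm_div,
    Complex.norm_I, Complex.norm_real]
  field_simp

section Derivative

variable {h h' : ℝ → ℂ} (hd : ∀ x, HasDerivAt h (h' x) x) (hc : Continuous h')
include hd hc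

theorem integral_exp_neg_I_mul_mul {ξ : ℝ} (hξ : ξ ≠ 0) (a b : ℝ) :
    ∫ x in a..b, Complex.exp (-(Complex.I * ξ * x)) * h x = Complex.I / ξ *
      (Complex.exp (-(Complex.I * ξ * b)) * h b - Complex.exp (-(Complex.I * ξ * a)) * h a -
        ∫ x in a..b, Complex.exp (-(Complex.I * ξ * x)) * h' x) := by
  have by_parts := intervalIntegral.integral_mul_deriv_eq_deriv_mul (a := a) (b := b)
    (fun x _ => hd x) (fun x _ => hasDerivAt_exp_neg_I_mul hξ x) (hc.intervalIntegrable _ _)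
    ((continuous_exp_neg_I_mul ξ).intervalIntegrable _ _)
  simp only [mul_left_comm (_ : ℂ) (Complex.I / (ξ : ℂ)),
    intervalIntegral.integral_const_mul] at by_parts
  simp only [mul_comm (Complex.exp _)]
  rw [by_parts]
  ring

theorem partialFourier_of_hasDerivAt {ξ : ℝ} (hξ : ξ ≠ 0) (R : ℝ) :
    partialFourier h ξ R = Complex.I / ξ *
      (Complex.exp (-(Complex.I * ξ * R)) * h R -
        Complex.exp (-(Complex.I * ξ * (-R : ℝ))) * h (-R) - partialFourier h' ξ R) :=
  integral_exp_neg_I_mul_mul hd hc hξ (-R) R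

theorem enorm_le_lintegral_deriv (hlim : Tendsto h (cocompact ℝ) (𝓝 0)) (x : ℝ) :
    ‖h x‖ₑ ≤ ∫⁻ y, ‖h' y‖ₑ := by
  have increment_le (b : ℝ) : ‖h b - h x‖ₑ ≤ ∫⁻ y, ‖h' y‖ₑ := by
    rw [← intervalIntegral.integral_eq_sub_of_hasDerivAt (fun y _ => hd y)
      (hc.intervalIntegrable _ _), ← ofReal_norm, intervalIntegral.norm_intervalIntegral_eq,
      ofReal_norm]
    exact (enorm_integral_le_lintegral_enorm _).trans (setLIntegral_le_lintegral _ _)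
  have htends := ((hlim.mono_left atTop_le_cocompact).sub_const (h x)).enorm
  rw [zero_sub, enorm_neg] at htends
  exact le_of_tendsto' htends increment_le

theorem enorm_mul_enorm_partialFourier_le (hlim : Tendsto h (cocompact ℝ) (𝓝 0)) (ξ R : ℝ) :
    ‖ξ‖ₑ * ‖partialFourier h ξ R‖ₑ ≤ 3 * ∫⁻ y, ‖h' y‖ₑ := by
  rcases eq_or_ne ξ 0 with rfl | hξ
  · simp
  have boundary_le (x : ℝ) : ‖Complex.exp (-(Complex.I * ξ * x)) * h x‖ₑ ≤ ∫⁻ y, ‖h' y‖ₑ := by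
    rw [enorm_mul, enorm_exp_neg_I_mul, one_mul]
    exact enorm_le_lintegral_deriv hd hc hlim x
  rw [partialFourier_of_hasDerivAt hd hc hξ, enorm_mul_enorm_I_div_mul hξ]
  calc _ ≤ (∫⁻ y, ‖h' y‖ₑ) + (∫⁻ y, ‖h' y‖ₑ) + ∫⁻ y, ‖h' y‖ₑ :=
        enorm_sub_le.trans (add_le_add (enorm_sub_le.trans (add_le_add (boundary_le _)
          (boundary_le _))) (enorm_partialFourier_le_lintegral h' ξ R))
    _ = _ := by ring

theorem HasPVFourier.of_deriv (hlim : Tendsto h (cocompact ℝ) (𝓝 0)) {ξ : ℝ} (hξ : ξ ≠ 0) {b : ℂ}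
    (hb : HasPVFourier h' ξ b) : HasPVFourier h ξ (Complex.I / ξ * -b) := by
  have boundary {u : ℝ → ℝ} (hu : Tendsto u atTop (cocompact ℝ)) :
      Tendsto (fun R => Complex.exp (-(Complex.I * ξ * (u R : ℝ))) * h (u R)) atTop (𝓝 0) := by
    rw [tendsto_zero_iff_norm_tendsto_zero]
    simpa only [Function.comp_def, norm_mul, norm_exp_neg_I_mul, one_mul, norm_zero]
      using (hlim.comp hu).norm
  have hlim' := (((boundary (tendsto_id.mono_right atTop_le_cocompact)).sub
    (boundary (tendsto_neg_atTop_atBot.mono_right atBot_le_cocompact))).sub hb).const_mul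
      (Complex.I / (ξ : ℂ))
  rw [sub_zero, zero_sub] at hlim'
  exact hlim'.congr fun R => (partialFourier_of_hasDerivAt hd hc hξ R).symm

end Derivative

end PartialFourier

theorem mul_enorm_sq_le_of_tendsto {ι E : Type*} [TopologicalSpace E] [ContinuousENorm E]
    {l : Filter ι} [l.NeBot] {u : ι → E} {a : E} (hu : Tendsto u l (𝓝 a)) {C K : ℝ≥0∞} (hC : C ≠ ⊤)
    (h : ∀ i, C * ‖u i‖ₑ ^ 2 ≤ K) : C * ‖a‖ₑ ^ 2 ≤ K :=
  le_of_tendsto' (ENNReal.Tendsto.const_mul (ENNReal.Tendsto.pow hu.enorm) (.inr hC)) h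

theorem exists_tendsto_of_tendstoUniformly {ι α E : Type*} [PseudoMetricSpace E] [CompleteSpace E]
    {p : Filter ι} [p.NeBot] {q : Filter α} [q.NeBot] {F : ι → α → E} {f : α → E} {L : ι → E}
    (hF : TendstoUniformly F f p) (hL : ∀ i, Tendsto (F i) q (𝓝 (L i))) :
    ∃ ℓ, Tendsto L p (𝓝 ℓ) ∧ Tendsto f q (𝓝 ℓ) := by
  have hcauchy : Cauchy (map L p) := by
    refine Metric.cauchy_iff.2 ⟨inferInstance, fun ε hε => ?_⟩
    have hclose := Metric.tendstoUniformly_iff.1 hF (ε / 4) (by positivity)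
    refine ⟨_, image_mem_map hclose, ?_⟩
    rintro _ ⟨i, hi, rfl⟩ _ ⟨j, hj, rfl⟩
    have hij : dist (L i) (L j) ≤ ε / 4 + ε / 4 :=
      le_of_tendsto' ((hL i).dist (hL j)) fun a =>
        (dist_triangle_left _ _ (f a)).trans (add_le_add (hi a).le (hj a).le)
    linarith
  obtain ⟨ℓ, hℓ⟩ := CompleteSpace.complete hcauchy
  exact ⟨ℓ, hℓ, hF.tendsto_of_eventually_tendsto (.of_forall hL) hℓ⟩

section PrincipalValue

variable {β : ℝ} (hβ : 0 < β)
include hβ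

theorem partialFourier_mobiusSeries_sub {c d : ℤ → ℂ}
    (hc : Summable fun k => ‖c k‖) (hd : Summable fun k => ‖d k‖) (ξ R : ℝ) :
    partialFourier (mobiusSeries β (c - d)) ξ R =
      partialFourier (mobiusSeries β c) ξ R - partialFourier (mobiusSeries β d) ξ R := by
  rw [← partialFourier_sub (mobiusSeries_continuous hβ hc) (mobiusSeries_continuous hβ hd),
    funext (mobiusSeries_sub hβ hc hd)]

theorem hasSum_partialFourier {c : ℤ → ℂ} (hc : Summable fun k => ‖c k‖) (ξ R : ℝ) :
    HasSum (fun k => c k * partialFourier (fun x => mobius β x ^ k - 1) ξ R)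
      (partialFourier (mobiusSeries β c) ξ R) := by
  have hcont (k : ℤ) : Continuous fun x : ℝ =>
      Complex.exp (-(Complex.I * ξ * x)) * (c k * (mobius β x ^ k - 1)) :=
    (continuous_exp_neg_I_mul ξ).mul
      (continuous_const.mul ((mobius_zpow_continuous hβ k).sub continuous_const))
  have h := intervalIntegral.hasSum_integral_of_dominated_convergence (a := -R) (b := R)
    (μ := volume) (fun k _ => ‖c k‖ * 2) (fun k => (hcont k).aestronglyMeasurable)
    (fun k => .of_forall fun x _ => by
      rw [norm_mul, norm_exp_neg_I_mul, one_mul]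
      exact norm_mul_mobius_zpow_sub_one_le hβ c k x)
    (.of_forall fun _ _ => hc.mul_right 2) intervalIntegrable_const
    (.of_forall fun x _ => (summable_mobiusSeries hβ hc x).hasSum.mul_left _)
  simpa only [mul_left_comm _ (c _), intervalIntegral.integral_const_mul, partialFourier,
    mobiusSeries] using h

theorem tendsto_partialFourier_truncate {c : ℤ → ℂ} (hc : Summable fun k => ‖c k‖) (ξ R : ℝ) :
    Tendsto (fun S : Finset ℤ => partialFourier (mobiusSeries β (truncate S c)) ξ R) atTop
      (𝓝 (partialFourier (mobiusSeries β c) ξ R)) := by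
  refine Tendsto.congr (fun S => ?_) (hasSum_partialFourier hβ hc ξ R)
  have hS := summable_norm_of_finite (truncate_finite S c)
  rw [← (hasSum_partialFourier hβ hS ξ R).tsum_eq, tsum_eq_sum (s := S)]
  · exact Finset.sum_congr rfl fun k hk => by simp [truncate, hk]
  · exact fun k hk => by simp [truncate, hk]

theorem partialFourier_mobiusSeries_sq_le {c : ℤ → ℂ} (hc : weightedSq 1 c ≠ ⊤) (ξ R : ℝ) :
    ‖ξ‖ₑ ^ 2 * ‖partialFourier (mobiusSeries β c) ξ R‖ₑ ^ 2 ≤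
      (3 * ENNReal.ofReal (2 * Real.pi)) ^ 2 * weightedSq 1 c := by
  have finite_case {d : ℤ → ℂ} (hd : d.support.Finite) :
      ‖ξ‖ₑ ^ 2 * ‖partialFourier (mobiusSeries β d) ξ R‖ₑ ^ 2 ≤
        (3 * ENNReal.ofReal (2 * Real.pi)) ^ 2 * weightedSq 1 d := by
    calc _ = (‖ξ‖ₑ * ‖partialFourier (mobiusSeries β d) ξ R‖ₑ) ^ 2 := (mul_pow _ _ _).symm
      _ ≤ (3 * ∫⁻ x, ‖mobiusSeries β (derivCoef β d) x‖ₑ) ^ 2 := by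
          gcongr ?_ ^ 2
          exact enorm_mul_enorm_partialFourier_le (hasDerivAt_mobiusSeries hβ hd)
            (mobiusSeries_continuous hβ (summable_norm_of_finite (derivCoef_finite β hd)))
            (tendsto_mobiusSeries hβ hd) ξ R
      _ ≤ _ := by
          rw [mul_pow, mul_pow, mul_assoc]
          gcongr
          exact sq_lintegral_mobiusSeries_derivCoef_le hβ hd
  have hlim := tendsto_partialFourier_truncate hβ
    (summable_norm_of_weightedSq one_half_lt_one hc) ξ R
  refine mul_enorm_sq_le_of_tendsto hlim (by finiteness) fun S =>
    (finite_case (truncate_finite S c)).trans ?_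
  gcongr
  exact weightedSq_mono (enorm_truncate_le S c)

theorem tendstoUniformly_partialFourier_truncate {c : ℤ → ℂ} (hc : weightedSq 1 c ≠ ⊤) {ξ : ℝ}
    (hξ : ξ ≠ 0) :
    TendstoUniformly (fun S : Finset ℤ => partialFourier (mobiusSeries β (truncate S c)) ξ)
      (partialFourier (mobiusSeries β c) ξ) atTop := by
  set C := (3 * ENNReal.ofReal (2 * Real.pi)) ^ 2
  have hlim : Tendsto (fun S : Finset ℤ => C * weightedSq 1 (c - truncate S c)) atTop (𝓝 0) := by
    simpa using ENNReal.Tendsto.const_mul (a := C) (tendsto_weightedSq_sub_truncate hc)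
      (.inr (by finiteness))
  refine EMetric.tendstoUniformly_iff.2 fun ε hε => ?_
  have hpos : 0 < ‖ξ‖ₑ ^ 2 * ε ^ 2 := by
    have : 0 < ‖ξ‖ₑ := enorm_pos.2 hξ
    positivity
  filter_upwards [hlim.eventually_lt_const hpos] with S hS R
  have hdiff := (partialFourier_mobiusSeries_sq_le hβ (ne_top_of_le_ne_top hc
    (weightedSq_mono (enorm_sub_truncate_le S c))) ξ R).trans_lt hS
  rw [edist_eq_enorm_sub, ← partialFourier_mobiusSeries_sub hβ
    (summable_norm_of_weightedSq one_half_lt_one hc)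
    (summable_norm_of_finite (truncate_finite S c))]
  exact lt_of_not_ge fun hle => hdiff.not_ge (by gcongr)

theorem exists_hasPVFourier_of_finite {c : ℤ → ℂ} (hc : c.support.Finite) {ξ : ℝ} (hξ : ξ ≠ 0) :
    ∃ a b, HasPVFourier (mobiusSeries β c) ξ a ∧ HasPVFourier (mobiusSeries β (derivCoef β c)) ξ b ∧
      ‖ξ‖ₑ * ‖a‖ₑ = ‖b‖ₑ := by
  have hcont := mobiusSeries_continuous hβ (summable_norm_of_finite (derivCoef_finite β hc))
  have hint : Integrable (mobiusSeries β (derivCoef β c)) := by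
    refine ⟨hcont.aestronglyMeasurable, ?_⟩
    refine (ENNReal.pow_lt_top_iff.1 ?_).resolve_right two_ne_zero
    exact (sq_lintegral_mobiusSeries_derivCoef_le hβ hc).trans_lt
      (ENNReal.mul_lt_top (by finiteness) (weightedSq_ne_top_of_finite 1 hc).lt_top)
  obtain ⟨b, hb⟩ := exists_hasPVFourier_of_integrable hint ξ
  exact ⟨_, b, .of_deriv (hasDerivAt_mobiusSeries hβ hc) hcont (tendsto_mobiusSeries hβ hc) hξ hb,
    hb, by rw [enorm_mul_enorm_I_div_mul hξ, enorm_neg]⟩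

theorem exists_hasPVFourier_sq_le_of_finite (j : ℕ) :
    ∃ C : ℝ≥0∞, C ≠ ⊤ ∧ ∀ c : ℤ → ℂ, c.support.Finite → ∀ ξ : ℝ, ξ ≠ 0 →
      ∃ a, HasPVFourier (mobiusSeries β c) ξ a ∧
        ‖ξ‖ₑ ^ (2 * (j + 1)) * ‖a‖ₑ ^ 2 ≤ C * weightedSq (j + 1) c := by
  induction j with
  | zero =>
    refine ⟨(3 * ENNReal.ofReal (2 * Real.pi)) ^ 2, by finiteness, fun c hc ξ hξ => ?_⟩
    obtain ⟨a, -, ha, -⟩ := exists_hasPVFourier_of_finite hβ hc hξ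
    refine ⟨a, ha, ?_⟩
    simp only [zero_add, mul_one, Nat.cast_zero]
    exact mul_enorm_sq_le_of_tendsto ha (by finiteness)
      (partialFourier_mobiusSeries_sq_le hβ (weightedSq_ne_top_of_finite 1 hc) ξ)
  | succ j ih =>
    obtain ⟨C, hC, h⟩ := ih
    obtain ⟨C', hC', h'⟩ := exists_weightedSq_derivCoef_le β (s := (j : ℝ) + 1) (by positivity)
    refine ⟨C * C', ENNReal.mul_ne_top hC hC', fun c hc ξ hξ => ?_⟩
    obtain ⟨a, b, ha, hb, hab⟩ := exists_hasPVFourier_of_finite hβ hc hξ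
    obtain ⟨b', hb', hle⟩ := h _ (derivCoef_finite β hc) ξ hξ
    obtain rfl := hb.unique hb'
    refine ⟨a, ha, ?_⟩
    calc ‖ξ‖ₑ ^ (2 * (j + 1 + 1)) * ‖a‖ₑ ^ 2 = ‖ξ‖ₑ ^ (2 * (j + 1)) * (‖ξ‖ₑ * ‖a‖ₑ) ^ 2 := by ring
      _ = ‖ξ‖ₑ ^ (2 * (j + 1)) * ‖b‖ₑ ^ 2 := by rw [hab]
      _ ≤ C * weightedSq (j + 1) (derivCoef β c) := hle
      _ ≤ C * (C' * weightedSq (j + 1 + 1) c) := by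
          gcongr
          exact h' c
      _ = _ := by
          push_cast
          ring

theorem exists_hasPVFourier_sq_le (j : ℕ) :
    ∃ C : ℝ≥0∞, C ≠ ⊤ ∧ ∀ c : ℤ → ℂ, weightedSq (j + 1) c ≠ ⊤ → ∀ ξ : ℝ, ξ ≠ 0 →
      ∃ a, HasPVFourier (mobiusSeries β c) ξ a ∧
        ‖ξ‖ₑ ^ (2 * (j + 1)) * ‖a‖ₑ ^ 2 ≤ C * weightedSq (j + 1) c := by
  obtain ⟨C, hC, h⟩ := exists_hasPVFourier_sq_le_of_finite hβ j
  refine ⟨C, hC, fun c hc ξ hξ => ?_⟩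
  have hc' : weightedSq 1 c ≠ ⊤ :=
    ne_top_of_le_ne_top hc (weightedSq_mono_exponent (le_add_of_nonneg_left j.cast_nonneg) c)
  choose b hb hb_le using fun S : Finset ℤ => h _ (truncate_finite S c) ξ hξ
  obtain ⟨a, hba, ha⟩ := exists_tendsto_of_tendstoUniformly
    (tendstoUniformly_partialFourier_truncate hβ hc' hξ) hb
  refine ⟨a, ha, mul_enorm_sq_le_of_tendsto hba (by finiteness) fun S => (hb_le S).trans ?_⟩
  gcongr
  exact weightedSq_mono (enorm_truncate_le S c)

end PrincipalValue

/-! ### Bounds uniform in the frequency -/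

section OddPart

theorem partialFourier_eq_integral_add_neg {h : ℝ → ℂ} (hh : Continuous h) (ξ R : ℝ) :
    partialFourier h ξ R = (∫ x in 0..R, Complex.exp (-(Complex.I * ξ * x)) * h x) +
      ∫ x in 0..R, Complex.exp (-(Complex.I * (-ξ : ℝ) * x)) * h (-x) := by
  have hint := intervalIntegrable_exp_neg_I_mul_mul hh ξ
  have hreflect := intervalIntegral.integral_comp_neg (a := 0) (b := R)
    fun x : ℝ => Complex.exp (-(Complex.I * ξ * x)) * h x
  rw [neg_zero] at hreflect
  rw [partialFourier, ← intervalIntegral.integral_add_adjacent_intervals (hint _ 0) (hint 0 _),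
    ← hreflect, add_comm]
  congr 2
  ext x
  push_cast
  ring_nf

theorem partialFourier_eq_add_integral {h : ℝ → ℂ} (hh : Continuous h) (ξ r R : ℝ) :
    partialFourier h ξ R = partialFourier h ξ r +
      ((∫ x in r..R, Complex.exp (-(Complex.I * ξ * x)) * h x) +
        ∫ x in r..R, Complex.exp (-(Complex.I * (-ξ : ℝ) * x)) * h (-x)) := by
  have hint := intervalIntegrable_exp_neg_I_mul_mul hh ξ
  have hint_neg := intervalIntegrable_exp_neg_I_mul_mul (hh.comp continuous_neg) (-ξ)
  simp only [Function.comp_def] at hint_neg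
  simp only [partialFourier_eq_integral_add_neg hh]
  rw [← intervalIntegral.integral_add_adjacent_intervals (hint 0 r) (hint r R),
    ← intervalIntegral.integral_add_adjacent_intervals (hint_neg 0 r) (hint_neg r R)]
  ring

theorem norm_exp_neg_I_mul_sub_one_le (ξ x : ℝ) :
    ‖Complex.exp (-(Complex.I * ξ * x)) - 1‖ ≤ |ξ| * |x| := by
  have h := Real.norm_exp_I_mul_ofReal_sub_one_le (x := -(ξ * x))
  rw [norm_neg, norm_mul, Real.norm_eq_abs, Real.norm_eq_abs] at h
  convert h using 4
  push_cast
  ring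

variable {h h' : ℝ → ℂ} {A : ℝ}

theorem norm_integral_exp_sub_one_mul_le (hA : ∀ x, ‖h x‖ * |x| ≤ A) {ξ r : ℝ} (hr : 0 ≤ r)
    (hξr : |ξ| * r ≤ 1) :
    ‖∫ x in 0..r, (Complex.exp (-(Complex.I * ξ * x)) - 1) * h x‖ ≤ A := by
  have hA0 : 0 ≤ A := by simpa using hA 0
  calc _ ≤ |ξ| * A * |r - 0| := by
        refine intervalIntegral.norm_integral_le_of_norm_le_const fun x _ => ?_
        calc _ ≤ |ξ| * |x| * ‖h x‖ := by
              rw [norm_mul]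
              gcongr
              exact norm_exp_neg_I_mul_sub_one_le ξ x
          _ = |ξ| * (‖h x‖ * |x|) := by ring
          _ ≤ |ξ| * A := by
              gcongr
              exact hA x
    _ = A * (|ξ| * r) := by
        rw [sub_zero, abs_of_nonneg hr]
        ring
    _ ≤ A := mul_le_of_le_one_right hA0 hξr

theorem norm_integral_exp_mul_le_of_one_le (hd : ∀ x, HasDerivAt h (h' x) x) (hc : Continuous h')
    (hA : ∀ x, ‖h x‖ * |x| ≤ A) (hA' : ∀ x, ‖h' x‖ * x ^ 2 ≤ A) {ξ a b : ℝ} (ha : 0 < a)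
    (hab : a ≤ b) (hξa : 1 ≤ |ξ| * a) :
    ‖∫ x in a..b, Complex.exp (-(Complex.I * ξ * x)) * h x‖ ≤ 2 * A := by
  have hA0 : 0 ≤ A := by simpa using hA 0
  have hξ : 0 < |ξ| := pos_of_mul_pos_left (one_pos.trans_le hξa) ha.le
  have pos_of_mem {x : ℝ} (hx : a ≤ x) : 0 < x := ha.trans_le hx
  have boundary_le {x : ℝ} (hx : a ≤ x) : ‖Complex.exp (-(Complex.I * ξ * x)) * h x‖ ≤ A / x := by
    rw [norm_mul, norm_exp_neg_I_mul, one_mul, le_div_iff₀ (pos_of_mem hx)]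
    simpa only [abs_of_pos (pos_of_mem hx)] using hA x
  have hzero : (0 : ℝ) ∉ Set.uIcc a b := by
    rw [Set.uIcc_of_le hab]
    exact fun h0 => ha.not_ge h0.1
  have hdiv : ∫ x in a..b, A * x ^ (-2 : ℤ) = A / a - A / b := by
    rw [intervalIntegral.integral_const_mul, integral_zpow (.inr ⟨by norm_num, hzero⟩)]
    norm_num [zpow_neg_one]
    ring
  have tail_le : ‖∫ x in a..b, Complex.exp (-(Complex.I * ξ * x)) * h' x‖ ≤ A / a - A / b := by
    rw [← hdiv]
    refine intervalIntegral.norm_integral_le_of_norm_le hab (.of_forall fun x hx => ?_)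
      ((intervalIntegral.intervalIntegrable_zpow (.inr hzero)).const_mul A)
    rw [norm_mul, norm_exp_neg_I_mul, one_mul, zpow_neg, ← div_eq_mul_inv,
      le_div_iff₀ (zpow_pos (pos_of_mem hx.1.le) 2)]
    exact_mod_cast hA' x
  rw [integral_exp_neg_I_mul_mul hd hc (abs_pos.1 hξ), norm_mul, norm_div, Complex.norm_I,
    Complex.norm_real, Real.norm_eq_abs, one_div_mul_eq_div, div_le_iff₀ hξ]
  calc _ ≤ A / b + A / a + (A / a - A / b) :=
        (norm_sub_le _ _).trans (add_le_add ((norm_sub_le _ _).trans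
          (add_le_add (boundary_le hab) (boundary_le le_rfl))) tail_le)
    _ = 2 * A * a⁻¹ := by ring
    _ ≤ 2 * A * |ξ| := by
        gcongr
        exact (inv_le_iff_one_le_mul₀ ha).2 hξa

theorem enorm_partialFourier_le_of_mul_le_one (hh : Continuous h) (hA : ∀ x, ‖h x‖ * |x| ≤ A)
    {ξ r : ℝ} (hr : 0 ≤ r) (hξr : |ξ| * r ≤ 1) :
    ‖partialFourier h ξ r‖ₑ ≤ (∫⁻ x, ‖h x + h (-x)‖ₑ) + ENNReal.ofReal (2 * A) := by
  have hint {g : ℝ → ℂ} (hg : Continuous g) : IntervalIntegrable g volume 0 r :=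
    hg.intervalIntegrable _ _
  have hneg : Continuous fun x => h (-x) := hh.comp continuous_neg
  have hsplit : partialFourier h ξ r = (∫ x in 0..r, (h x + h (-x))) +
      ((∫ x in 0..r, (Complex.exp (-(Complex.I * ξ * x)) - 1) * h x) +
        ∫ x in 0..r, (Complex.exp (-(Complex.I * (-ξ : ℝ) * x)) - 1) * h (-x)) := by
    simp only [sub_mul, one_mul]
    rw [partialFourier_eq_integral_add_neg hh, intervalIntegral.integral_add (hint hh) (hint hneg),
      intervalIntegral.integral_sub (intervalIntegrable_exp_neg_I_mul_mul hh _ _ _) (hint hh),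
      intervalIntegral.integral_sub (intervalIntegrable_exp_neg_I_mul_mul hneg _ _ _) (hint hneg)]
    ring
  rw [hsplit]
  refine (enorm_add_le _ _).trans (add_le_add ?_ ?_)
  · rw [intervalIntegral.integral_of_le hr]
    exact (enorm_integral_le_lintegral_enorm _).trans (setLIntegral_le_lintegral _ _)
  · have hle := norm_integral_exp_sub_one_mul_le hA hr hξr
    have hle' := norm_integral_exp_sub_one_mul_le (h := fun x => h (-x)) (ξ := -ξ)
      (fun x => by simpa only [abs_neg] using hA (-x)) hr (by rwa [abs_neg])
    rw [← ofReal_norm]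
    exact ENNReal.ofReal_le_ofReal ((norm_add_le _ _).trans (by linarith))

/-- The odd part of `h` is invisible to symmetric integrals at low frequencies, so decay of order
`1 / |x|`, together with oscillation, replaces its integrability. -/
theorem enorm_partialFourier_le_lintegral_add_neg (hd : ∀ x, HasDerivAt h (h' x) x)
    (hc : Continuous h') (hA : ∀ x, ‖h x‖ * |x| ≤ A) (hA' : ∀ x, ‖h' x‖ * x ^ 2 ≤ A) (ξ : ℝ)
    {R : ℝ} (hR : 0 ≤ R) :
    ‖partialFourier h ξ R‖ₑ ≤ (∫⁻ x, ‖h x + h (-x)‖ₑ) + ENNReal.ofReal (6 * A) := by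
  have hA0 : 0 ≤ A := by simpa using hA 0
  have hh : Continuous h := continuous_iff_continuousAt.2 fun x => (hd x).continuousAt
  rcases le_or_gt (|ξ| * R) 1 with hlow | hhigh
  · refine (enorm_partialFourier_le_of_mul_le_one hh hA hR hlow).trans ?_
    gcongr
    norm_num
  have hξ : 0 < |ξ| := pos_of_mul_pos_left (one_pos.trans hhigh) hR
  have hr : 0 < |ξ|⁻¹ := inv_pos.2 hξ
  have hξr : |ξ| * |ξ|⁻¹ = 1 := mul_inv_cancel₀ hξ.ne'
  have hrR : |ξ|⁻¹ ≤ R := (inv_le_iff_one_le_mul₀' hξ).2 hhigh.le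
  have tail := norm_integral_exp_mul_le_of_one_le hd hc hA hA' hr hrR hξr.ge
  have tail_neg := norm_integral_exp_mul_le_of_one_le (h := fun x => h (-x)) (ξ := -ξ)
    (fun x => (hd (-x)).scomp x (hasDerivAt_neg x)) (by fun_prop)
    (fun x => by simpa only [abs_neg] using hA (-x))
    (fun x => by simpa only [neg_smul, one_smul, norm_neg, neg_sq] using hA' (-x)) hr hrR
    (by rw [abs_neg, hξr])
  calc _ ≤ (∫⁻ x, ‖h x + h (-x)‖ₑ) + ENNReal.ofReal (2 * A) + ENNReal.ofReal (4 * A) := by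
        rw [partialFourier_eq_add_integral hh ξ |ξ|⁻¹ R]
        refine (enorm_add_le _ _).trans (add_le_add
          (enorm_partialFourier_le_of_mul_le_one hh hA hr.le hξr.le) ?_)
        rw [← ofReal_norm]
        exact ENNReal.ofReal_le_ofReal ((norm_add_le _ _).trans (by linarith))
    _ = _ := by
        rw [add_assoc, ← ENNReal.ofReal_add (by positivity) (by positivity)]
        ring_nf

theorem exists_hasPVFourier_of_integrable_add_neg (hd : ∀ x, HasDerivAt h (h' x) x)
    (hc : Continuous h') (hlim : Tendsto h (cocompact ℝ) (𝓝 0)) (hint : Integrable h')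
    (heven : Integrable fun x => h x + h (-x)) (ξ : ℝ) : ∃ a, HasPVFourier h ξ a := by
  rcases eq_or_ne ξ 0 with rfl | hξ
  · have hh : Continuous h := continuous_iff_continuousAt.2 fun x => (hd x).continuousAt
    have hneg : Continuous fun x => h (-x) := hh.comp continuous_neg
    refine ⟨_, (intervalIntegral_tendsto_integral_Ioi 0 heven.integrableOn tendsto_id).congr
      fun R => ?_⟩
    have := partialFourier_eq_integral_add_neg hh 0 R
    simp only [partialFourier, neg_zero, Complex.ofReal_zero, mul_zero, zero_mul, Complex.exp_zero,
      one_mul] at this ⊢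
    rw [this, id, intervalIntegral.integral_add (hh.intervalIntegrable _ _)
      (hneg.intervalIntegrable _ _)]
  · obtain ⟨b, hb⟩ := exists_hasPVFourier_of_integrable hint ξ
    exact ⟨_, .of_deriv hd hc hlim hξ hb⟩

end OddPart

theorem norm_zpow_sub_one_le_abs_mul {z : ℂ} (hz : ‖z‖ = 1) (k : ℤ) :
    ‖z ^ k - 1‖ ≤ |(k : ℝ)| * ‖z - 1‖ := by
  rw [norm_zpow_sub_one_natAbs hz, ← geom_sum_mul, norm_mul, ← Int.cast_abs, Int.abs_eq_natAbs]
  gcongr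
  refine (norm_sum_le _ _).trans ?_
  simp [hz]

section MobiusPower

variable {β : ℝ} (hβ : 0 < β)
include hβ

theorem mobiusWeight_mul_sq_le (x : ℝ) : mobiusWeight β x * x ^ 2 ≤ 2 * β := by
  rw [mobiusWeight, div_mul_eq_mul_div, div_le_iff₀ (by positivity)]
  nlinarith [pow_pos hβ 3]

theorem norm_mobius_zpow_sub_one_mul_abs_le (k : ℤ) (x : ℝ) :
    ‖mobius β x ^ k - 1‖ * |x| ≤ 2 * β * |(k : ℝ)| := by
  have hsq : (‖1 - mobius β x‖ * |x|) ^ 2 ≤ (2 * β) ^ 2 := by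
    rw [mul_pow, norm_one_sub_mobius_sq hβ, sq_abs, mul_assoc, sq (2 * β)]
    exact mul_le_mul_of_nonneg_left (mobiusWeight_mul_sq_le hβ x) (by positivity)
  calc _ ≤ |(k : ℝ)| * ‖1 - mobius β x‖ * |x| := by
        rw [norm_sub_rev 1]
        gcongr
        exact norm_zpow_sub_one_le_abs_mul (norm_mobius hβ x) k
    _ = (‖1 - mobius β x‖ * |x|) * |(k : ℝ)| := by ring
    _ ≤ _ := mul_le_mul_of_nonneg_right (le_of_sq_le_sq hsq (by positivity)) (abs_nonneg _)

theorem norm_deriv_mobius_zpow_mul_sq_le (k : ℤ) (x : ℝ) :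
    ‖Complex.I * k * mobiusWeight β x * mobius β x ^ k‖ * x ^ 2 ≤ 2 * β * |(k : ℝ)| := by
  rw [norm_mul, norm_mobius_zpow hβ, norm_mul, norm_mul, Complex.norm_I, Complex.norm_intCast,
    Complex.norm_real, Real.norm_of_nonneg (mobiusWeight_pos hβ x).le, one_mul, mul_one, mul_assoc,
    mul_comm]
  exact mul_le_mul_of_nonneg_right (mobiusWeight_mul_sq_le hβ x) (abs_nonneg _)

theorem continuous_deriv_mobius_zpow (k : ℤ) :
    Continuous fun x : ℝ => Complex.I * k * mobiusWeight β x * mobius β x ^ k :=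
  (continuous_const.mul (Complex.continuous_ofReal.comp (mobiusWeight_continuous hβ))).mul
    (mobius_zpow_continuous hβ k)

/-- Since `M_β(-x)` is the conjugate of `M_β(x)`, the even part of `M_β ^ k - 1` is its real
part. -/
theorem enorm_mobius_zpow_sub_one_add_neg (k : ℤ) (x : ℝ) :
    ‖(mobius β x ^ k - 1) + (mobius β (-x : ℝ) ^ k - 1)‖ₑ = ‖mobius β x ^ k - 1‖ₑ ^ 2 := by
  have hneg : mobius β (-x : ℝ) = (mobius β x)⁻¹ := by
    rw [mobius, mobius, inv_div, ← neg_div_neg_eq]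
    push_cast
    ring_nf
  have h0 := zpow_ne_zero k (mobius_ne_zero hβ x)
  have hmul : (mobius β x ^ k - 1) + (mobius β (-x : ℝ) ^ k - 1) =
      (mobius β x ^ k)⁻¹ * (mobius β x ^ k - 1) ^ 2 := by
    rw [hneg, inv_zpow]
    field_simp
    ring
  rw [hmul, enorm_mul, enorm_pow, enorm_inv h0, ← ofReal_norm (mobius β x ^ k),
    norm_mobius_zpow hβ, ENNReal.ofReal_one, inv_one, one_mul]

theorem exists_hasPVFourier_mobius_zpow (k : ℤ) (ξ : ℝ) :
    ∃ a, HasPVFourier (fun x => mobius β x ^ k - 1) ξ a := by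
  refine exists_hasPVFourier_of_integrable_add_neg
    (fun x => (hasDerivAt_mobius_zpow hβ k x).sub_const 1) (continuous_deriv_mobius_zpow hβ k)
    (by simpa using (tendsto_mobius_zpow hβ k).sub_const 1) ?_ ⟨?_, ?_⟩ ξ
  · exact ((integrable_mobiusWeight_mul_zpow hβ k).const_mul (Complex.I * k)).congr
      (.of_forall fun x => by simp only [mul_assoc])
  · have hc := (mobius_zpow_continuous hβ k).sub (continuous_const (y := (1 : ℂ)))
    exact (hc.add (hc.comp continuous_neg)).aestronglyMeasurable
  · simp only [HasFiniteIntegral, enorm_mobius_zpow_sub_one_add_neg hβ,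
      lintegral_enorm_mobius_zpow_sub_one_sq hβ]
    finiteness

theorem enorm_partialFourier_mobius_zpow_le (k : ℤ) (ξ : ℝ) {R : ℝ} (hR : 0 ≤ R) :
    ‖partialFourier (fun x => mobius β x ^ k - 1) ξ R‖ₑ ≤
      ENNReal.ofReal (4 * Real.pi * β + 12 * β) * bracket k := by
  have hle := enorm_partialFourier_le_lintegral_add_neg
    (fun x => (hasDerivAt_mobius_zpow hβ k x).sub_const 1) (continuous_deriv_mobius_zpow hβ k)
    (norm_mobius_zpow_sub_one_mul_abs_le hβ k) (norm_deriv_mobius_zpow_mul_sq_le hβ k) ξ hR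
  simp only [enorm_mobius_zpow_sub_one_add_neg hβ, lintegral_enorm_mobius_zpow_sub_one_sq hβ]
    at hle
  have hk : ENNReal.ofReal |(k : ℝ)| = ‖k‖ₑ := by
    rw [← Int.norm_eq_abs, ofReal_norm]
  calc _ ≤ ENNReal.ofReal (4 * Real.pi * β + 12 * β) * ‖k‖ₑ := by
        refine hle.trans_eq ?_
        rw [ENNReal.ofReal_add (by positivity) (by positivity), add_mul, ← hk,
          ← ENNReal.ofReal_mul (p := 12 * β) (by positivity)]
        ring_nf
    _ ≤ _ := by
        gcongr
        exact le_add_self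

theorem exists_hasPVFourier_le_absMoment :
    ∃ C : ℝ≥0∞, C ≠ ⊤ ∧ ∀ c, absMoment 1 c ≠ ⊤ → ∀ ξ : ℝ, ∃ a,
      HasPVFourier (mobiusSeries β c) ξ a ∧ ‖a‖ₑ ≤ C * absMoment 1 c := by
  set C := ENNReal.ofReal (4 * Real.pi * β + 12 * β)
  refine ⟨C, ENNReal.ofReal_ne_top, fun c hc ξ => ?_⟩
  choose p hp using fun k => exists_hasPVFourier_mobius_zpow hβ k ξ
  have hmajorant {z : ℂ} {k : ℤ} (hz : ‖z‖ₑ ≤ C * bracket k) :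
      ‖c k * z‖ₑ ≤ C * (bracket k ^ (1 : ℝ) * ‖c k‖ₑ) := by
    rw [enorm_mul, ENNReal.rpow_one, mul_comm, ← mul_assoc]
    gcongr
  have hfin : ∑' k, C * (bracket k ^ (1 : ℝ) * ‖c k‖ₑ) ≠ ⊤ := by
    rw [ENNReal.tsum_mul_left]
    exact ENNReal.mul_ne_top ENNReal.ofReal_ne_top hc
  have hp_le (k : ℤ) : ‖p k‖ₑ ≤ C * bracket k :=
    le_of_tendsto (hp k).enorm ((eventually_ge_atTop 0).mono fun R hR =>
      enorm_partialFourier_mobius_zpow_le hβ k ξ hR)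
  refine ⟨∑' k, c k * p k, ?_, ?_⟩
  · refine (tendsto_tsum_of_dominated_convergence (ENNReal.summable_toReal hfin)
      (fun k => (hp k).const_mul (c k)) ((eventually_ge_atTop 0).mono fun R hR k => ?_)).congr
      fun R => (hasSum_partialFourier hβ (summable_norm_of_absMoment zero_le_one hc) ξ R).tsum_eq
    rw [← toReal_enorm]
    exact ENNReal.toReal_mono (ENNReal.ne_top_of_tsum_ne_top hfin k)
      (hmajorant (enorm_partialFourier_mobius_zpow_le hβ k ξ hR))
  · refine enorm_tsum_le_tsum_enorm.trans ?_
    rw [absMoment, ← ENNReal.tsum_mul_left]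
    exact ENNReal.tsum_le_tsum fun k => hmajorant (hp_le k)

theorem exists_hasPVFourier_le_weightedSq {σ : ℝ} (hσ : 3 / 2 < σ) :
    ∃ C : ℝ≥0∞, C ≠ ⊤ ∧ ∀ c, weightedSq σ c ≠ ⊤ → ∀ ξ : ℝ, ∃ a,
      HasPVFourier (mobiusSeries β c) ξ a ∧ ‖a‖ₑ ^ 2 ≤ C * weightedSq σ c := by
  obtain ⟨C, hC, h⟩ := exists_hasPVFourier_le_absMoment hβ
  have hr : 1 < 2 * (σ - 1) := by linarith
  refine ⟨C ^ 2 * ∑' k : ℤ, bracket k ^ (-(2 * (σ - 1))),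
    ENNReal.mul_ne_top (by finiteness) (tsum_bracket_rpow_ne_top hr), fun c hc ξ => ?_⟩
  obtain ⟨a, ha, hle⟩ := h c (absMoment_ne_top hr hc) ξ
  refine ⟨a, ha, ?_⟩
  calc ‖a‖ₑ ^ 2 ≤ (C * absMoment 1 c) ^ 2 := by gcongr
    _ ≤ _ := by
        rw [mul_pow, mul_assoc]
        gcongr
        exact absMoment_sq_le 1 σ c

end MobiusPower

/-! ### The Fourier transform of square integrable functions -/

open scoped SchwartzMap LineDeriv

theorem eLpNorm_two_sq {α E : Type*} [MeasurableSpace α] [NormedAddCommGroup E] (μ : Measure α)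
    (h : α → E) : eLpNorm h 2 μ ^ 2 = ∫⁻ x, ‖h x‖ₑ ^ 2 ∂μ := by
  simpa using eLpNorm_nnreal_pow_eq_lintegral (μ := μ) (f := h) (p := 2) two_ne_zero

theorem memLp_two_of_lintegral_sq_ne_top {α E : Type*} [MeasurableSpace α]
    [NormedAddCommGroup E] {μ : Measure α} {h : α → E} (hm : AEStronglyMeasurable h μ)
    (hfin : ∫⁻ x, ‖h x‖ₑ ^ 2 ∂μ ≠ ⊤) : MemLp h 2 μ := by
  refine ⟨hm, lt_top_iff_ne_top.2 fun htop => hfin ?_⟩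
  simp [← eLpNorm_two_sq, htop]

theorem map_volume_div_right {a : ℝ} (ha : 0 < a) :
    Measure.map (fun x : ℝ => x / a) volume = ENNReal.ofReal a • volume := by
  simpa [div_eq_mul_inv, abs_of_pos ha] using Real.map_volume_mul_right (inv_ne_zero ha.ne')

theorem lintegral_comp_div_right {a : ℝ} (ha : 0 < a) {g : ℝ → ℝ≥0∞} (hg : Measurable g) :
    ∫⁻ x, g (x / a) = ENNReal.ofReal a * ∫⁻ x, g x := by
  rw [← lintegral_map (f := g) (g := fun x : ℝ => x / a) hg (by fun_prop),
    map_volume_div_right ha, lintegral_smul_measure, smul_eq_mul]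

theorem ae_comp_div_right {a : ℝ} (ha : 0 < a) {p : ℝ → Prop} (h : ∀ᵐ x, p x) :
    ∀ᵐ x, p (x / a) := by
  refine ae_of_ae_map (f := fun x : ℝ => x / a) (by fun_prop) (p := p) ?_
  rw [map_volume_div_right ha]
  exact Measure.ae_smul_measure h _

theorem l2Fourier_eq {h : ℝ → ℂ} (hh : MemLp h 2 (volume : Measure ℝ)) (k : ℝ) :
    l2Fourier h k = (𝓕 (hh.toLp h) : Lp ℂ 2 (volume : Measure ℝ)) (k / (2 * Real.pi)) := by
  rw [l2Fourier, dif_pos hh]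

theorem measurable_l2Fourier (h : ℝ → ℂ) : Measurable (l2Fourier h) := by
  by_cases hh : MemLp h 2 (volume : Measure ℝ)
  · rw [funext (l2Fourier_eq hh)]
    exact (Lp.stronglyMeasurable _).measurable.comp (by fun_prop)
  · have hzero : l2Fourier h = 0 := funext fun k => dif_neg hh
    rw [hzero]
    exact measurable_zero

theorem lintegral_l2Fourier_sq {h : ℝ → ℂ} (hh : MemLp h 2 (volume : Measure ℝ)) :
    ∫⁻ k, ‖l2Fourier h k‖ₑ ^ 2 = ENNReal.ofReal (2 * Real.pi) * ∫⁻ x, ‖h x‖ₑ ^ 2 := by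
  simp only [l2Fourier_eq hh]
  rw [lintegral_comp_div_right Real.two_pi_pos (g := fun x =>
    ‖(𝓕 (hh.toLp h) : Lp ℂ 2 (volume : Measure ℝ)) x‖ₑ ^ 2)
    ((Lp.stronglyMeasurable _).measurable.enorm.pow_const 2)]
  congr 1
  rw [← eLpNorm_two_sq, ← Lp.enorm_def, ← ofReal_norm, Lp.norm_fourier_eq, ofReal_norm,
    Lp.enorm_def, eLpNorm_congr_ae hh.coeFn_toLp, eLpNorm_two_sq]

theorem l2Fourier_sub {g h : ℝ → ℂ} (hg : MemLp g 2 (volume : Measure ℝ))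
    (hh : MemLp h 2 (volume : Measure ℝ)) :
    ∀ᵐ k, l2Fourier (g - h) k = l2Fourier g k - l2Fourier h k := by
  have heq : (𝓕 ((hg.sub hh).toLp _) : Lp ℂ 2 (volume : Measure ℝ)) =
      𝓕 (hg.toLp g) - 𝓕 (hh.toLp h) := by
    rw [MemLp.toLp_sub]
    exact map_sub (Lp.fourierTransformₗᵢ ℝ ℂ) _ _
  filter_upwards [ae_comp_div_right Real.two_pi_pos
    (Lp.coeFn_sub (𝓕 (hg.toLp g) : Lp ℂ 2 (volume : Measure ℝ)) (𝓕 (hh.toLp h)))] with k hk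
  rw [l2Fourier_eq (hg.sub hh), l2Fourier_eq hg, l2Fourier_eq hh, heq, hk, Pi.sub_apply]

theorem lineDeriv_toLp_eq {h h' : ℝ → ℂ} (hh : MemLp h 2 (volume : Measure ℝ))
    (hh' : MemLp h' 2 (volume : Measure ℝ)) (hd : ∀ x, HasDerivAt h (h' x) x) :
    ∂_{(1 : ℝ)} ((hh.toLp h : Lp ℂ 2 (volume : Measure ℝ)) : 𝓢'(ℝ, ℂ)) =
      ((hh'.toLp h' : Lp ℂ 2 (volume : Measure ℝ)) : 𝓢'(ℝ, ℂ)) := by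
  ext φ
  have hφ : MemLp φ 2 (volume : Measure ℝ) := φ.memLp 2
  have hφ' : MemLp (deriv φ) 2 (volume : Measure ℝ) := by
    exact (SchwartzMap.derivCLM ℂ ℂ φ).memLp 2
  rw [TemperedDistribution.lineDerivOp_apply_apply, Lp.toTemperedDistribution_apply,
    Lp.toTemperedDistribution_apply]
  calc ∫ x, (-∂_{(1 : ℝ)} φ) x • (hh.toLp h : Lp ℂ 2 (volume : Measure ℝ)) x
      = -∫ x, deriv φ x * h x := by
        rw [← integral_neg]
        refine integral_congr_ae ?_
        filter_upwards [hh.coeFn_toLp] with x hx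
        simp [hx, SchwartzMap.lineDerivOp_apply_eq_fderiv]
    _ = ∫ x, φ x * h' x := by
        rw [integral_mul_deriv_eq_deriv_mul_of_integrable
          (fun x _ => (φ.differentiable x).hasDerivAt) (fun x _ => hd x)
          (hφ.integrable_mul hh') (hφ'.integrable_mul hh) (hφ.integrable_mul hh)]
    _ = ∫ x, φ x • (hh'.toLp h' : Lp ℂ 2 (volume : Measure ℝ)) x := by
        refine integral_congr_ae ?_
        filter_upwards [hh'.coeFn_toLp] with x hx
        rw [hx, smul_eq_mul]

theorem ae_fourier_eq_of_lineDeriv_eq {u v : Lp ℂ 2 (volume : Measure ℝ)}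
    (huv : ∂_{(1 : ℝ)} (u : 𝓢'(ℝ, ℂ)) = (v : 𝓢'(ℝ, ℂ))) :
    ∀ᵐ ξ : ℝ, (𝓕 v : Lp ℂ 2 (volume : Measure ℝ)) ξ =
      2 * Real.pi * Complex.I * ξ * (𝓕 u : Lp ℂ 2 (volume : Measure ℝ)) ξ := by
  have hF := TemperedDistribution.fourier_lineDerivOp_eq (u : 𝓢'(ℝ, ℂ)) (1 : ℝ)
  rw [huv, Lp.fourier_toTemperedDistribution_eq, Lp.fourier_toTemperedDistribution_eq] at hF
  have hloc (w : Lp ℂ 2 (volume : Measure ℝ)) : LocallyIntegrable (w : ℝ → ℂ) :=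
    (Lp.memLp w).locallyIntegrable one_le_two
  refine ae_eq_of_integral_contDiff_smul_eq (hloc _) ((hloc _).continuous_mul (by fun_prop))
    fun g hg hgc => ?_
  have hsupp : HasCompactSupport (Complex.ofRealCLM ∘ g) := hgc.comp_left rfl
  have hsmooth : ContDiff ℝ ((⊤ : ℕ∞) : WithTop ℕ∞) (Complex.ofRealCLM ∘ g) :=
    Complex.ofRealCLM.contDiff.comp hg
  have htest := congrArg (fun T : 𝓢'(ℝ, ℂ) => T (hsupp.toSchwartzMap hsmooth)) hF
  have hgrowth : (fun x : ℝ => (x : ℂ)).HasTemperateGrowth := by fun_prop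
  simp only [Lp.toTemperedDistribution_apply, HasCompactSupport.toSchwartzMap_toFun,
    Function.comp_apply, Complex.ofRealCLM_apply, smul_eq_mul, RCLike.inner_apply,
    Real.ringHom_apply, one_mul, smul_apply, TemperedDistribution.smulLeftCLM_apply_apply,
    SchwartzMap.smulLeftCLM_apply_apply hgrowth] at htest
  simp only [Complex.real_smul]
  rw [htest, ← integral_const_mul]
  refine integral_congr_ae (Eventually.of_forall fun x => ?_)
  ring

theorem l2Fourier_deriv {h h' : ℝ → ℂ} (hh : MemLp h 2 (volume : Measure ℝ))
    (hh' : MemLp h' 2 (volume : Measure ℝ)) (hd : ∀ x, HasDerivAt h (h' x) x) :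
    ∀ᵐ k : ℝ, l2Fourier h' k = Complex.I * k * l2Fourier h k := by
  filter_upwards [ae_comp_div_right Real.two_pi_pos
    (ae_fourier_eq_of_lineDeriv_eq (lineDeriv_toLp_eq hh hh' hd))] with k hk
  rw [l2Fourier_eq hh', l2Fourier_eq hh, hk]
  push_cast
  field_simp

theorem lintegral_mul_l2Fourier_sq_le_of_tendsto {ι : Type*} {l : Filter ι} [l.NeBot]
    [l.IsCountablyGenerated] {H : ι → ℝ → ℂ} {h : ℝ → ℂ}
    (hH : ∀ i, MemLp (H i) 2 (volume : Measure ℝ)) (hh : MemLp h 2 (volume : Measure ℝ))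
    (hlim : Tendsto (fun i => ∫⁻ x, ‖(h - H i) x‖ₑ ^ 2) l (𝓝 0)) {w : ℝ → ℝ≥0∞}
    (hw : Measurable w) (hwtop : ∀ k, w k ≠ ⊤) {K : ℝ≥0∞}
    (hK : ∀ i, ∫⁻ k, w k * ‖l2Fourier (H i) k‖ₑ ^ 2 ≤ K) :
    ∫⁻ k, w k * ‖l2Fourier h k‖ₑ ^ 2 ≤ K := by
  have hsq (i : ι) : eLpNorm (l2Fourier (H i) - l2Fourier h) 2 volume ^ 2 =
      ENNReal.ofReal (2 * Real.pi) * ∫⁻ x, ‖(h - H i) x‖ₑ ^ 2 := by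
    rw [eLpNorm_two_sq, ← lintegral_l2Fourier_sq (hh.sub (hH i))]
    refine lintegral_congr_ae ?_
    filter_upwards [l2Fourier_sub hh (hH i)] with k hk
    rw [hk, Pi.sub_apply, enorm_sub_rev]
  have hL2 : Tendsto (fun i => eLpNorm (l2Fourier (H i) - l2Fourier h) 2 volume) l (𝓝 0) := by
    have hzero := (ENNReal.Tendsto.const_mul (a := ENNReal.ofReal (2 * Real.pi)) hlim
      (Or.inr ENNReal.ofReal_ne_top)).ennrpow_const (1 / 2)
    simp only [← hsq, ← ENNReal.rpow_natCast_mul] at hzero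
    simpa using hzero
  obtain ⟨φ, -, hφ⟩ := (tendstoInMeasure_of_tendsto_eLpNorm two_ne_zero
    (fun i => (measurable_l2Fourier (H i)).aestronglyMeasurable)
    (measurable_l2Fourier h).aestronglyMeasurable hL2).exists_seq_tendsto_ae'
  calc ∫⁻ k, w k * ‖l2Fourier h k‖ₑ ^ 2
      ≤ ∫⁻ k, liminf (fun n => w k * ‖l2Fourier (H (φ n)) k‖ₑ ^ 2) atTop := by
        refine lintegral_mono_ae ?_
        filter_upwards [hφ] with k hk
        exact (ENNReal.Tendsto.const_mul (ENNReal.Tendsto.pow (n := 2) hk.enorm)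
          (Or.inr (hwtop k))).liminf_eq.ge
    _ ≤ liminf (fun n => ∫⁻ k, w k * ‖l2Fourier (H (φ n)) k‖ₑ ^ 2) atTop :=
        lintegral_liminf_le fun n =>
          hw.mul ((measurable_l2Fourier (H (φ n))).enorm.pow_const 2)
    _ ≤ K := liminf_le_of_frequently_le' (Frequently.of_forall fun n => hK (φ n))

/-! ### Real interpolation between weighted `L²` spaces -/

/-- The Mellin transform `∫_0^∞ min(1, a^p) a^{-σ-1} da`, written in the variable `r = log a`. It
is the constant in the real interpolation of weighted `L²` spaces. -/
noncomputable def mellinMinOne (p σ : ℝ) : ℝ≥0∞ :=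
  ∫⁻ r : ℝ, ENNReal.ofReal (Real.exp (-(σ * r))) * min 1 (ENNReal.ofReal (Real.exp r) ^ p)

theorem mellinMinOne_ne_zero (p σ : ℝ) : mellinMinOne p σ ≠ 0 := by
  intro hzero
  rw [mellinMinOne, lintegral_eq_zero_iff (by fun_prop)] at hzero
  obtain ⟨r, hr⟩ := hzero.exists
  have hpos : 0 < ENNReal.ofReal (Real.exp r) ^ p := by
    rw [ENNReal.ofReal_rpow_of_pos (Real.exp_pos r)]
    positivity
  exact mul_ne_zero (by positivity) (lt_min one_pos hpos).ne' hr

section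

variable {p σ : ℝ} (hσ : 0 < σ) (hσp : σ < p)

include hσ hσp

theorem mellinMinOne_ne_top : mellinMinOne p σ ≠ ⊤ := by
  have hneg := (integrableOn_exp_mul_Iic (sub_pos.2 hσp) 0).lintegral_lt_top.ne
  have hpos := (integrableOn_exp_mul_Ioi (neg_lt_zero.2 hσ) 0).lintegral_lt_top.ne
  rw [mellinMinOne, ← lintegral_add_compl _ (measurableSet_Iic (a := (0 : ℝ))), Set.compl_Iic]
  refine ENNReal.add_ne_top.2 ⟨ne_top_of_le_ne_top hneg (lintegral_mono fun r => ?_),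
    ne_top_of_le_ne_top hpos (lintegral_mono fun r => ?_)⟩
  · refine (mul_le_mul_right (min_le_right _ _) _).trans_eq ?_
    rw [ENNReal.ofReal_rpow_of_pos (Real.exp_pos r), ← ENNReal.ofReal_mul (Real.exp_nonneg _),
      ← Real.exp_mul, ← Real.exp_add]
    ring_nf
  · refine (mul_le_mul_right (min_le_left _ _) _).trans_eq ?_
    rw [mul_one, neg_mul]

theorem lintegral_exp_mul_min_one_eq {a : ℝ≥0∞} (ha : a ≠ ⊤) :
    ∫⁻ r : ℝ, ENNReal.ofReal (Real.exp (-(σ * r))) *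
      min 1 ((ENNReal.ofReal (Real.exp r) * a) ^ p) = mellinMinOne p σ * a ^ σ := by
  rcases eq_or_ne a 0 with rfl | ha0
  · simp [hσ, hσ.trans hσp]
  obtain ⟨b, rfl⟩ : ∃ b : ℝ, a = ENNReal.ofReal (Real.exp b) :=
    ⟨Real.log a.toReal, by rw [Real.exp_log (ENNReal.toReal_pos ha0 ha), ENNReal.ofReal_toReal ha]⟩
  rw [mellinMinOne, ← lintegral_add_right_eq_self
      (fun r => ENNReal.ofReal (Real.exp (-(σ * r))) * min 1 (ENNReal.ofReal (Real.exp r) ^ p)) b,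
    mul_comm,
    ENNReal.ofReal_rpow_of_pos (Real.exp_pos b), ← lintegral_const_mul' _ _ ENNReal.ofReal_ne_top]
  refine lintegral_congr fun r => ?_
  rw [← ENNReal.ofReal_mul (Real.exp_nonneg r), ← Real.exp_add, ← mul_assoc,
    ← ENNReal.ofReal_mul (by positivity), ← Real.exp_mul, ← Real.exp_add]
  ring_nf

theorem mellinMinOne_mul_lintegral {X : Type*} [MeasurableSpace X] (μ : Measure X) [SFinite μ]
    {w u : X → ℝ≥0∞} (hw : Measurable w) (hu : Measurable u) (hw_top : ∀ x, w x ≠ ⊤) :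
    mellinMinOne p σ * ∫⁻ x, w x ^ σ * u x ∂μ =
      ∫⁻ r : ℝ, ENNReal.ofReal (Real.exp (-(σ * r))) *
        ∫⁻ x, min 1 ((ENNReal.ofReal (Real.exp r) * w x) ^ p) * u x ∂μ := by
  simp only [← lintegral_const_mul' _ _ ENNReal.ofReal_ne_top,
    ← lintegral_const_mul' _ _ (mellinMinOne_ne_top hσ hσp)]
  rw [lintegral_lintegral_swap (by fun_prop)]
  refine lintegral_congr fun x => ?_
  rw [← mul_assoc, ← lintegral_exp_mul_min_one_eq hσ hσp (hw_top x),
    ← lintegral_mul_const _ (by fun_prop)]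
  exact lintegral_congr fun r => mul_assoc _ _ _

theorem lintegral_rpow_mul_le_of_min_one {X Y : Type*} [MeasurableSpace X] [MeasurableSpace Y]
    {μ : Measure X} {ν : Measure Y} [SFinite μ] [SFinite ν] {w u : X → ℝ≥0∞} {v g : Y → ℝ≥0∞}
    (hw : Measurable w) (hu : Measurable u) (hv : Measurable v) (hg : Measurable g)
    (hw_top : ∀ x, w x ≠ ⊤) (hv_top : ∀ y, v y ≠ ⊤) {C : ℝ≥0∞} (hC : C ≠ ⊤)
    (h : ∀ a : ℝ≥0∞, a ≠ ⊤ →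
      ∫⁻ x, min 1 ((a * w x) ^ p) * u x ∂μ ≤ C * ∫⁻ y, min 1 ((a * v y) ^ p) * g y ∂ν) :
    ∫⁻ x, w x ^ σ * u x ∂μ ≤ C * ∫⁻ y, v y ^ σ * g y ∂ν := by
  refine (ENNReal.mul_le_mul_iff_right (mellinMinOne_ne_zero p σ)
    (mellinMinOne_ne_top hσ hσp)).1 ?_
  rw [mul_left_comm, mellinMinOne_mul_lintegral hσ hσp μ hw hu hw_top,
    mellinMinOne_mul_lintegral hσ hσp ν hv hg hv_top, ← lintegral_const_mul' _ _ hC]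
  refine lintegral_mono fun r => ?_
  rw [mul_left_comm]
  gcongr
  exact h _ ENNReal.ofReal_ne_top

end

/-! ### Sobolev norms of `∑ c_k (M_β^k - 1)` -/

section

variable {β : ℝ}

theorem memLp_mobiusSeries (hβ : 0 < β) {c : ℤ → ℂ} (hc : absMoment (1 / 2) c ≠ ⊤) :
    MemLp (mobiusSeries β c) 2 (volume : Measure ℝ) := by
  have hs := summable_norm_of_absMoment (by norm_num) hc
  refine memLp_two_of_lintegral_sq_ne_top
    (mobiusSeries_continuous hβ hs).aestronglyMeasurable ?_
  exact ne_top_of_le_ne_top (by finiteness) (lintegral_mobiusSeries_sq_le hβ c)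

theorem memLp_mobiusSeries_of_finite (hβ : 0 < β) {c : ℤ → ℂ} (hc : c.support.Finite) :
    MemLp (mobiusSeries β c) 2 (volume : Measure ℝ) :=
  memLp_mobiusSeries hβ (absMoment_ne_top_of_finite _ hc)

theorem enorm_l2Fourier_derivCoef_sq (hβ : 0 < β) {c : ℤ → ℂ} (hc : c.support.Finite) :
    ∀ᵐ ξ : ℝ, ‖l2Fourier (mobiusSeries β (derivCoef β c)) ξ‖ₑ ^ 2 =
      ‖ξ‖ₑ ^ 2 * ‖l2Fourier (mobiusSeries β c) ξ‖ₑ ^ 2 := by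
  filter_upwards [l2Fourier_deriv (memLp_mobiusSeries_of_finite hβ hc)
    (memLp_mobiusSeries_of_finite hβ (derivCoef_finite β hc))
    (hasDerivAt_mobiusSeries hβ hc)] with ξ hξ
  rw [hξ, enorm_mul, enorm_mul, mul_pow, mul_pow]
  simp [← ofReal_norm]

theorem exists_lintegral_pow_mul_l2Fourier_sq_le (hβ : 0 < β) (j : ℕ) :
    ∃ C : ℝ≥0∞, C ≠ ⊤ ∧ ∀ c : ℤ → ℂ, c.support.Finite →
      ∫⁻ ξ : ℝ, ‖ξ‖ₑ ^ (2 * (j + 1)) * ‖l2Fourier (mobiusSeries β c) ξ‖ₑ ^ 2 ≤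
        C * weightedSq (j + 1) c := by
  have shift (j : ℕ) {c : ℤ → ℂ} (hc : c.support.Finite) :
      ∫⁻ ξ : ℝ, ‖ξ‖ₑ ^ (2 * (j + 1)) * ‖l2Fourier (mobiusSeries β c) ξ‖ₑ ^ 2 =
        ∫⁻ ξ : ℝ, ‖ξ‖ₑ ^ (2 * j) * ‖l2Fourier (mobiusSeries β (derivCoef β c)) ξ‖ₑ ^ 2 := by
    refine lintegral_congr_ae ?_
    filter_upwards [enorm_l2Fourier_derivCoef_sq hβ hc] with ξ hξ
    rw [hξ]
    ring
  induction j with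
  | zero =>
    refine ⟨ENNReal.ofReal (2 * Real.pi) * ENNReal.ofReal (4 * Real.pi / β), by finiteness,
      fun c hc => ?_⟩
    rw [shift 0 hc]
    simp only [mul_zero, pow_zero, one_mul, Nat.cast_zero, zero_add]
    rw [lintegral_l2Fourier_sq (memLp_mobiusSeries_of_finite hβ (derivCoef_finite β hc)), mul_assoc]
    gcongr
    exact lintegral_mobiusSeries_derivCoef_sq_le hβ hc
  | succ j ih =>
    obtain ⟨C, hC, h⟩ := ih
    obtain ⟨C', hC', h'⟩ := exists_weightedSq_derivCoef_le β (s := (j : ℝ) + 1) (by positivity)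
    refine ⟨C * C', ENNReal.mul_ne_top hC hC', fun c hc => ?_⟩
    rw [shift (j + 1) hc, mul_assoc]
    refine (h _ (derivCoef_finite β hc)).trans ?_
    gcongr
    push_cast
    exact h' c

theorem enorm_l2Fourier_mobiusSeries_sq_le (hβ : 0 < β) {c d : ℤ → ℂ} (hc : c.support.Finite)
    (hd : d.support.Finite) :
    ∀ᵐ ξ, ‖l2Fourier (mobiusSeries β c) ξ‖ₑ ^ 2 ≤
      2 * (‖l2Fourier (mobiusSeries β d) ξ‖ₑ ^ 2 +
        ‖l2Fourier (mobiusSeries β (c - d)) ξ‖ₑ ^ 2) := by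
  have hsub : mobiusSeries β (c - d) = mobiusSeries β c - mobiusSeries β d :=
    funext fun x => mobiusSeries_sub hβ (summable_norm_of_finite hc) (summable_norm_of_finite hd) x
  filter_upwards [l2Fourier_sub (memLp_mobiusSeries_of_finite hβ hc)
    (memLp_mobiusSeries_of_finite hβ hd)] with ξ hξ
  rw [hsub, hξ]
  simpa only [add_sub_cancel] using enorm_add_sq_le (l2Fourier (mobiusSeries β d) ξ)
    (l2Fourier (mobiusSeries β c) ξ - l2Fourier (mobiusSeries β d) ξ)

/-- The part of a sequence on the indices with `a⟨k⟩ > 1`, the piece estimated in `H¹` when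
interpolating between `H¹` and `H^{j+1}`. -/
noncomputable def highPart (a : ℝ≥0∞) (c : ℤ → ℂ) : ℤ → ℂ :=
  {k : ℤ | 1 < a * bracket k}.indicator c

theorem highPart_finite (a : ℝ≥0∞) {c : ℤ → ℂ} (hc : c.support.Finite) :
    (highPart a c).support.Finite :=
  hc.subset (by simp [highPart])

theorem weightedSq_highPart_add (a : ℝ≥0∞) (j : ℕ) (c : ℤ → ℂ) :
    weightedSq 1 (highPart a c) + a ^ (2 * j) * weightedSq (j + 1) (c - highPart a c) =
      ∑' k, min 1 ((a * bracket k) ^ (2 * j)) * (bracket k ^ 2 * ‖c k‖ₑ ^ 2) := by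
  rw [weightedSq, weightedSq, ← ENNReal.tsum_mul_left, ← ENNReal.tsum_add]
  refine tsum_congr fun k => ?_
  have hpow : bracket k ^ (2 * ((j : ℝ) + 1)) = bracket k ^ (2 * j) * bracket k ^ 2 := by
    rw [← pow_add, ← ENNReal.rpow_natCast]
    push_cast
    ring_nf
  by_cases hk : 1 < a * bracket k
  · simp [highPart, hk, min_eq_left (one_le_pow₀ hk.le)]
  · simp [highPart, hk, hpow, min_eq_right (pow_le_one₀ zero_le (not_lt.1 hk))]
    ring

theorem min_one_mul_le_mul_add {x y z C : ℝ≥0∞} (h : x ≤ C * (y + z)) (m : ℝ≥0∞) :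
    min 1 m * x ≤ C * (y + m * z) :=
  calc min 1 m * x ≤ min 1 m * (C * (y + z)) := by gcongr
    _ = C * (min 1 m * y + min 1 m * z) := by ring
    _ ≤ C * (1 * y + m * z) := by
        gcongr
        · exact min_le_left _ _
        · exact min_le_right _ _
    _ = _ := by rw [one_mul]

theorem exists_lintegral_min_one_mul_l2Fourier_sq_le (hβ : 0 < β) (j : ℕ) :
    ∃ C : ℝ≥0∞, C ≠ ⊤ ∧ ∀ c : ℤ → ℂ, c.support.Finite → ∀ a : ℝ≥0∞, a ≠ ⊤ →
      ∫⁻ ξ : ℝ, min 1 ((a * ‖ξ‖ₑ) ^ (2 * j)) *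
          (‖ξ‖ₑ ^ 2 * ‖l2Fourier (mobiusSeries β c) ξ‖ₑ ^ 2) ≤
        C * ∑' k, min 1 ((a * bracket k) ^ (2 * j)) * (bracket k ^ 2 * ‖c k‖ₑ ^ 2) := by
  obtain ⟨C₁, hC₁, h₁⟩ := exists_lintegral_pow_mul_l2Fourier_sq_le hβ 0
  obtain ⟨C₂, hC₂, h₂⟩ := exists_lintegral_pow_mul_l2Fourier_sq_le hβ j
  refine ⟨2 * (C₁ + C₂), by finiteness, fun c hc a ha => ?_⟩
  set high := highPart a c
  set low := c - high
  have high_finite : high.support.Finite := highPart_finite a hc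
  have low_finite : low.support.Finite := (hc.union high_finite).subset (Function.support_sub _ _)
  set F : (ℤ → ℂ) → ℝ → ℝ≥0∞ := fun d ξ => ‖l2Fourier (mobiusSeries β d) ξ‖ₑ ^ 2
  have hF_meas (d : ℤ → ℂ) : Measurable (F d) := (measurable_l2Fourier _).enorm.pow_const 2
  calc ∫⁻ ξ : ℝ, min 1 ((a * ‖ξ‖ₑ) ^ (2 * j)) * (‖ξ‖ₑ ^ 2 * F c ξ)
      ≤ ∫⁻ ξ : ℝ, 2 * (‖ξ‖ₑ ^ (2 * (0 + 1)) * F high ξ +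
          a ^ (2 * j) * (‖ξ‖ₑ ^ (2 * (j + 1)) * F low ξ)) := by
        refine lintegral_mono_ae ?_
        filter_upwards [enorm_l2Fourier_mobiusSeries_sq_le hβ hc high_finite] with ξ hξ
        have hξ' : ‖ξ‖ₑ ^ 2 * F c ξ ≤ 2 * (‖ξ‖ₑ ^ 2 * F high ξ + ‖ξ‖ₑ ^ 2 * F low ξ) := by
          rw [← mul_add, mul_left_comm]
          gcongr
        refine (min_one_mul_le_mul_add hξ' ((a * ‖ξ‖ₑ) ^ (2 * j))).trans_eq ?_
        ring
    _ = 2 * ((∫⁻ ξ : ℝ, ‖ξ‖ₑ ^ (2 * (0 + 1)) * F high ξ) +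
          a ^ (2 * j) * ∫⁻ ξ : ℝ, ‖ξ‖ₑ ^ (2 * (j + 1)) * F low ξ) := by
        rw [lintegral_const_mul' _ _ (by finiteness), lintegral_add_left (by fun_prop),
          lintegral_const_mul' _ _ (by finiteness)]
    _ ≤ 2 * ((C₁ + C₂) * weightedSq 1 high +
          a ^ (2 * j) * ((C₁ + C₂) * weightedSq (j + 1) low)) := by
        gcongr
        · refine (h₁ _ high_finite).trans ?_
          simp only [Nat.cast_zero, zero_add]
          gcongr
          exact le_self_add
        · refine (h₂ _ low_finite).trans ?_
          gcongr
          exact le_add_self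
    _ = 2 * (C₁ + C₂) * ∑' k, min 1 ((a * bracket k) ^ (2 * j)) *
          (bracket k ^ 2 * ‖c k‖ₑ ^ 2) := by
        rw [← weightedSq_highPart_add]
        ring

theorem exists_lintegral_rpow_mul_l2Fourier_sq_le (hβ : 0 < β) {t : ℝ} (ht : 1 ≤ t) :
    ∃ C : ℝ≥0∞, C ≠ ⊤ ∧ ∀ c : ℤ → ℂ, c.support.Finite →
      ∫⁻ ξ : ℝ, ‖ξ‖ₑ ^ (2 * t) * ‖l2Fourier (mobiusSeries β c) ξ‖ₑ ^ 2 ≤ C * weightedSq t c := by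
  rcases ht.eq_or_lt with rfl | ht
  · obtain ⟨C, hC, h⟩ := exists_lintegral_pow_mul_l2Fourier_sq_le hβ 0
    exact ⟨C, hC, fun c hc => by simpa using h c hc⟩
  obtain ⟨j, hj⟩ := exists_nat_gt t
  obtain ⟨C, hC, h⟩ := exists_lintegral_min_one_mul_l2Fourier_sq_le hβ j
  refine ⟨C, hC, fun c hc => ?_⟩
  have hsplit (b : ℝ≥0∞) : b ^ (2 * t) = b ^ (2 * t - 2) * b ^ 2 := by
    rw [← ENNReal.rpow_two, ← ENNReal.rpow_add_of_nonneg _ _ (by linarith) zero_le_two,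
      sub_add_cancel]
  simp only [weightedSq, hsplit, mul_assoc]
  rw [← lintegral_count]
  have hmeas : Measurable fun ξ : ℝ => ‖ξ‖ₑ ^ 2 * ‖l2Fourier (mobiusSeries β c) ξ‖ₑ ^ 2 :=
    (measurable_enorm.pow_const 2).mul ((measurable_l2Fourier _).enorm.pow_const 2)
  refine lintegral_rpow_mul_le_of_min_one (p := (2 * j : ℕ)) (by linarith)
    (by push_cast; linarith) measurable_enorm hmeas .of_discrete .of_discrete
    (fun ξ => enorm_ne_top) bracket_ne_top hC fun a ha => ?_
  simpa only [lintegral_count, ENNReal.rpow_natCast] using h c hc a ha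

theorem sobolevNormR_sq (t : ℝ) (h : ℝ → ℂ) :
    sobolevNormR t h ^ 2 = ∫⁻ ξ : ℝ, bracket ξ ^ (2 * t) * ‖l2Fourier h ξ‖ₑ ^ 2 := by
  rw [sobolevNormR, eLpNorm_two_sq]
  refine lintegral_congr fun ξ => ?_
  rw [enorm_mul, mul_pow, ← bracket_rpow_sq, ← ofReal_one_add_norm_rpow, Real.norm_eq_abs,
    ← ofReal_norm (((1 + |ξ|) ^ t : ℝ) : ℂ), Complex.norm_real, Real.norm_of_nonneg (by positivity)]

theorem sobolevNormR_mono {t t' : ℝ} (htt' : t ≤ t') (h : ℝ → ℂ) :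
    sobolevNormR t h ≤ sobolevNormR t' h := by
  refine (ENNReal.pow_le_pow_left_iff two_ne_zero).1 ?_
  simp only [sobolevNormR_sq]
  gcongr with ξ
  exact one_le_bracket ξ

theorem sobolevNormR_sq_le_of_truncate (hβ : 0 < β) {c : ℤ → ℂ} (hc : absMoment (1 / 2) c ≠ ⊤)
    {t : ℝ} {K : ℝ≥0∞}
    (h : ∀ S : Finset ℤ, sobolevNormR t (mobiusSeries β (truncate S c)) ^ 2 ≤ K) :
    sobolevNormR t (mobiusSeries β c) ^ 2 ≤ K := by
  simp only [sobolevNormR_sq] at h ⊢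
  refine lintegral_mul_l2Fourier_sq_le_of_tendsto (l := atTop)
    (fun S => memLp_mobiusSeries_of_finite hβ (truncate_finite S c)) (memLp_mobiusSeries hβ hc)
    ?_ (by unfold bracket; fun_prop) (fun ξ => bracket_rpow_ne_top ξ _) h
  have hbound : Tendsto (fun S => ENNReal.ofReal (4 * Real.pi * β) *
      absMoment (1 / 2) (c - truncate S c) ^ 2) atTop (𝓝 0) := by
    simpa using ENNReal.Tendsto.const_mul (a := ENNReal.ofReal (4 * Real.pi * β))
      (ENNReal.Tendsto.pow (n := 2) (tendsto_absMoment_sub_truncate hc)) (Or.inr (by finiteness))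
  refine tendsto_of_tendsto_of_tendsto_of_le_of_le tendsto_const_nhds hbound (fun _ => zero_le)
    fun S => ?_
  have hsub : mobiusSeries β c - mobiusSeries β (truncate S c) =
      mobiusSeries β (c - truncate S c) :=
    funext fun x => (mobiusSeries_sub hβ (summable_norm_of_absMoment (by norm_num) hc)
      (summable_norm_of_finite (truncate_finite S c)) x).symm
  simpa only [hsub] using lintegral_mobiusSeries_sq_le hβ (c - truncate S c)

theorem exists_sobolevNormR_sq_le (hβ : 0 < β) (s : ℝ) :
    ∃ C₁ : ℝ≥0∞, C₁ ≠ ⊤ ∧ ∀ t, 1 ≤ t → t ≤ s → ∃ C₂ : ℝ≥0∞, C₂ ≠ ⊤ ∧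
      ∀ c : ℤ → ℂ, absMoment (1 / 2) c ≠ ⊤ → sobolevNormR t (mobiusSeries β c) ^ 2 ≤
        C₁ * absMoment (1 / 2) c ^ 2 + C₂ * weightedSq t c := by
  set A := ENNReal.ofReal (2 * Real.pi) * ENNReal.ofReal (4 * Real.pi * β)
  refine ⟨2 ^ (2 * s - 1) * A, by finiteness, fun t ht hts => ?_⟩
  obtain ⟨B, hB, h⟩ := exists_lintegral_rpow_mul_l2Fourier_sq_le hβ ht
  refine ⟨2 ^ (2 * s - 1) * B, by finiteness, fun c hc =>
    sobolevNormR_sq_le_of_truncate hβ hc fun S => ?_⟩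
  set d := truncate S c
  have hd : d.support.Finite := truncate_finite S c
  have hweight (ξ : ℝ) : bracket ξ ^ (2 * t) ≤ 2 ^ (2 * s - 1) * (1 + ‖ξ‖ₑ ^ (2 * t)) := by
    refine (ENNReal.rpow_add_le_mul_rpow_add_rpow 1 ‖ξ‖ₑ (by linarith : 1 ≤ 2 * t)).trans ?_
    rw [ENNReal.one_rpow]
    gcongr
    exact one_le_two
  have hL2 : ∫⁻ ξ, ‖l2Fourier (mobiusSeries β d) ξ‖ₑ ^ 2 ≤ A * absMoment (1 / 2) d ^ 2 := by
    rw [lintegral_l2Fourier_sq (memLp_mobiusSeries_of_finite hβ hd), mul_assoc]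
    gcongr
    exact lintegral_mobiusSeries_sq_le hβ d
  calc sobolevNormR t (mobiusSeries β d) ^ 2
      ≤ ∫⁻ ξ : ℝ, 2 ^ (2 * s - 1) * (‖l2Fourier (mobiusSeries β d) ξ‖ₑ ^ 2 +
          ‖ξ‖ₑ ^ (2 * t) * ‖l2Fourier (mobiusSeries β d) ξ‖ₑ ^ 2) := by
        rw [sobolevNormR_sq]
        refine lintegral_mono fun ξ => ?_
        rw [← one_add_mul, ← mul_assoc]
        gcongr
        exact hweight ξ
    _ ≤ 2 ^ (2 * s - 1) * (A * absMoment (1 / 2) d ^ 2 + B * weightedSq t d) := by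
        rw [lintegral_const_mul' _ _ (by finiteness),
          lintegral_add_left ((measurable_l2Fourier _).enorm.pow_const 2)]
        gcongr
        exact h d hd
    _ ≤ 2 ^ (2 * s - 1) * (A * absMoment (1 / 2) c ^ 2 + B * weightedSq t c) := by
        gcongr
        · exact absMoment_mono (enorm_truncate_le S c)
        · exact weightedSq_mono (enorm_truncate_le S c)
    _ = _ := by ring

end

/-! ### The pullback to the circle and its Fourier series -/

section

variable {β : ℝ}

theorem pullback_periodic (β : ℝ) (f : ℝ → ℂ) :
    Function.Periodic (pullback β f) (2 * Real.pi) := fun θ => by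
  have hexp : Complex.exp (Complex.I * (θ + 2 * Real.pi : ℝ)) = Complex.exp (Complex.I * θ) := by
    simpa [mul_comm Complex.I] using Complex.exp_mul_I_periodic (θ : ℂ)
  simp only [pullback, changeVar, hexp]

theorem pullback_zero (β : ℝ) (f : ℝ → ℂ) : pullback β f 0 = 0 := by
  simp [pullback]

theorem norm_changeVar (hβ : 0 < β) (θ : ℝ) :
    ‖changeVar β θ‖ = β * ‖Complex.exp (Complex.I * θ) + 1‖ *
      ‖Complex.exp (Complex.I * θ) - 1‖⁻¹ := by
  rw [← Complex.norm_real, changeVar_eq, mobiusInv, norm_mul, norm_div, norm_div, Complex.norm_I,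
    Complex.norm_real, Real.norm_of_nonneg hβ.le]
  ring

theorem tendsto_changeVar_cocompact (hβ : 0 < β) {θ₀ : ℝ} (h₀ : Complex.exp (Complex.I * θ₀) = 1) :
    Tendsto (changeVar β) (𝓝[{θ | Complex.exp (Complex.I * θ) ≠ 1}] θ₀) (cocompact ℝ) := by
  set l := 𝓝[{θ : ℝ | Complex.exp (Complex.I * θ) ≠ 1}] θ₀
  have hexp : Tendsto (fun θ : ℝ => Complex.exp (Complex.I * θ)) l (𝓝 1) := by
    rw [← h₀]
    exact (by fun_prop : Continuous fun θ : ℝ => Complex.exp (Complex.I * θ)).continuousWithinAt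
  have hnum : Tendsto (fun θ : ℝ => β * ‖Complex.exp (Complex.I * θ) + 1‖) l (𝓝 (β * 2)) := by
    simpa [one_add_one_eq_two] using (hexp.add_const 1).norm.const_mul β
  have hden : Tendsto (fun θ : ℝ => ‖Complex.exp (Complex.I * θ) - 1‖) l (𝓝[>] 0) := by
    refine tendsto_nhdsWithin_iff.2 ⟨by simpa using (hexp.sub_const 1).norm, ?_⟩
    filter_upwards [self_mem_nhdsWithin] with θ hθ
    exact norm_pos_iff.2 (sub_ne_zero.2 hθ)
  rw [← Metric.cobounded_eq_cocompact, ← tendsto_norm_atTop_iff_cobounded]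
  simp only [norm_changeVar hβ]
  exact hnum.pos_mul_atTop (by positivity) (tendsto_inv_nhdsGT_zero.comp hden)

theorem continuousAt_changeVar (β : ℝ) {θ : ℝ} (h : Complex.exp (Complex.I * θ) ≠ 1) :
    ContinuousAt (changeVar β) θ := by
  unfold changeVar mobiusInv
  have := sub_ne_zero.2 h
  fun_prop (disch := assumption)

theorem pullback_continuous (hβ : 0 < β) {f : ℝ → ℂ} (hf : Continuous f)
    (hf0 : Tendsto f (cocompact ℝ) (𝓝 0)) : Continuous (pullback β f) := by
  refine continuous_iff_continuousAt.2 fun θ₀ => ?_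
  by_cases h₀ : Complex.exp (Complex.I * θ₀) = 1
  · rw [ContinuousAt, pullback, if_pos h₀]
    exact Tendsto.if tendsto_const_nhds (hf0.comp (tendsto_changeVar_cocompact hβ h₀))
  · refine (hf.continuousAt.comp (continuousAt_changeVar β h₀)).congr ?_
    have hexp : Continuous fun θ : ℝ => Complex.exp (Complex.I * θ) := by fun_prop
    filter_upwards [hexp.continuousAt.eventually_ne h₀] with θ hθ
    rw [pullback, if_neg hθ, Function.comp_apply]

theorem fourier_two_pi_coe_apply (k : ℤ) (θ : ℝ) :
    fourier k (θ : AddCircle (2 * Real.pi)) = Complex.exp (Complex.I * k * θ) := by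
  have hpi : (Real.pi : ℂ) ≠ 0 := by exact_mod_cast Real.pi_ne_zero
  rw [fourier_coe_apply]
  congr 1
  push_cast
  field_simp

theorem hasSum_fourierCoef {F : ℝ → ℂ} (hF : Continuous F)
    (hp : Function.Periodic F (2 * Real.pi)) (hs : Summable fun k => ‖fourierCoef F k‖) (θ : ℝ) :
    HasSum (fun k : ℤ => fourierCoef F k * Complex.exp (Complex.I * k * θ)) (F θ) := by
  have : Fact (0 < 2 * Real.pi) := ⟨by positivity⟩
  let G : C(AddCircle (2 * Real.pi), ℂ) := ⟨hp.lift, continuous_coinduced_dom.2 hF⟩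
  have hcoef : fourierCoeff G = fourierCoef F := funext fun k => by
    rw [fourierCoeff_eq_intervalIntegral G k 0, fourierCoef, zero_add, Complex.real_smul]
    push_cast
    congr 1
    refine intervalIntegral.integral_congr fun θ _ => ?_
    simp only [fourier_two_pi_coe_apply, smul_eq_mul, Int.cast_neg, mul_neg, neg_mul]
    rfl
  have hsum := has_pointwise_sum_fourier_series_of_summable (hcoef ▸ hs.of_norm) (θ : AddCircle _)
  simp only [hcoef, fourier_two_pi_coe_apply, smul_eq_mul] at hsum
  exact hsum

theorem mobiusInv_mobius (hβ : 0 < β) (x : ℝ) : mobiusInv β (mobius β x) = x := by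
  have hβ' : (β : ℂ) ≠ 0 := by exact_mod_cast hβ.ne'
  have hne := add_I_mul_ne_zero hβ x
  have hsub : mobius β x - 1 = -(2 * Complex.I * β) / (x + Complex.I * β) := by
    rw [neg_div, ← one_sub_mobius hβ, neg_sub]
  have hadd : mobius β x + 1 = 2 * x / (x + Complex.I * β) := by
    rw [mobius]
    field_simp
    ring
  have hI := Complex.I_ne_zero
  rw [mobiusInv, hsub, hadd, div_div_div_cancel_right₀ hne]
  field_simp
  rw [Complex.I_sq]
  ring

theorem mobius_ne_one (hβ : 0 < β) (x : ℝ) : mobius β x ≠ 1 := by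
  have hne : 1 - mobius β x ≠ 0 := by
    rw [one_sub_mobius hβ]
    have hβ' : (β : ℂ) ≠ 0 := by exact_mod_cast hβ.ne'
    exact div_ne_zero (by simp [hβ']) (add_I_mul_ne_zero hβ x)
  exact fun h => hne (sub_eq_zero.2 h.symm)

theorem exp_I_mul_arg_mobius (hβ : 0 < β) (x : ℝ) :
    Complex.exp (Complex.I * (mobius β x).arg) = mobius β x := by
  simpa [norm_mobius hβ, mul_comm Complex.I] using Complex.norm_mul_exp_arg_mul_I (mobius β x)

theorem pullback_arg_mobius (hβ : 0 < β) (f : ℝ → ℂ) (x : ℝ) :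
    pullback β f (mobius β x).arg = f x := by
  rw [pullback, changeVar, exp_I_mul_arg_mobius hβ, if_neg (mobius_ne_one hβ x),
    mobiusInv_mobius hβ, Complex.ofReal_re]

-- Subtracting the value `0` of the Fourier series at `θ = 0`, i.e. at `x = ∞`, turns each
-- exponential into `M_β ^ k - 1`, which decays.
theorem mobiusSeries_eq_of_hasSum (hβ : 0 < β) {f : ℝ → ℂ} {c : ℤ → ℂ}
    (h : ∀ θ : ℝ, HasSum (fun k : ℤ => c k * Complex.exp (Complex.I * k * θ)) (pullback β f θ)) :
    mobiusSeries β c = f := by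
  funext x
  have hsub := (h (mobius β x).arg).sub (h 0)
  rw [pullback_arg_mobius hβ, pullback_zero, sub_zero] at hsub
  rw [mobiusSeries, ← hsub.tsum_eq]
  refine tsum_congr fun k => ?_
  rw [mul_comm Complex.I k, mul_assoc, Complex.exp_int_mul, exp_I_mul_arg_mobius hβ]
  simp [mul_sub]

end

/-! ### Aliasing and the interpolation error -/

section

variable {n : ℕ}

theorem sum_range_exp_eq (hn : n ≠ 0) (d : ℤ) :
    ∑ l ∈ Finset.range n, Complex.exp (Complex.I * d * (2 * Real.pi * l / n : ℝ)) =
      if (n : ℤ) ∣ d then (n : ℂ) else 0 := by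
  have hζ := Complex.isPrimitiveRoot_exp n hn
  have hterm (l : ℕ) : Complex.exp (Complex.I * d * (2 * Real.pi * l / n : ℝ)) =
      (Complex.exp (2 * Real.pi * Complex.I / n) ^ d) ^ l := by
    rw [← Complex.exp_int_mul, ← Complex.exp_nat_mul]
    congr 1
    push_cast
    ring
  simp only [hterm]
  split_ifs with h
  · simp [(hζ.zpow_eq_one_iff_dvd d).2 h]
  · rw [geom_sum_eq (mt (hζ.zpow_eq_one_iff_dvd d).1 h), ← zpow_natCast, zpow_comm, zpow_natCast,
      hζ.pow_eq_one, one_zpow, sub_self, zero_div]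

/-- The frequencies that agree with the frequency `k` on the grid `θ_ℓ = 2πℓ/n`. -/
def aliases (n : ℕ) (k : ℤ) : Set ℤ := {j | (n : ℤ) ∣ j - k}

theorem mem_aliases {j k : ℤ} : j ∈ aliases n k ↔ (n : ℤ) ∣ j - k := Iff.rfl

theorem hasSum_discreteCoef {F : ℝ → ℂ} {c : ℤ → ℂ}
    (h : ∀ θ : ℝ, HasSum (fun k : ℤ => c k * Complex.exp (Complex.I * k * θ)) (F θ))
    (hn : n ≠ 0) (k : ℤ) : HasSum ((aliases n k).indicator c) (discreteCoef n F k) := by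
  have hn' : (n : ℂ) ≠ 0 := by exact_mod_cast hn
  refine ((hasSum_sum (s := Finset.range n) fun l _ => (h (2 * Real.pi * l / n)).mul_left
    (Complex.exp (-(Complex.I * k * (2 * Real.pi * l / n : ℝ))))).mul_left (1 / (n : ℂ))
    ).congr_fun fun j => ?_
  have hterm (l : ℕ) : Complex.exp (-(Complex.I * k * (2 * Real.pi * l / n : ℝ))) *
      (c j * Complex.exp (Complex.I * j * (2 * Real.pi * l / n : ℝ))) =
      c j * Complex.exp (Complex.I * (j - k : ℤ) * (2 * Real.pi * l / n : ℝ)) := by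
    rw [mul_left_comm, ← Complex.exp_add]
    congr 2
    push_cast
    ring
  simp only [hterm, ← Finset.mul_sum, sum_range_exp_eq hn, Set.indicator, mem_aliases]
  split_ifs <;> simp [field]

theorem existsUnique_mem_modes (hn : n ≠ 0) (j : ℤ) : ∃! k, k ∈ modes n ∧ j ∈ aliases n k := by
  have hmodes (k : ℤ) :
      k ∈ modes n ↔ k ∈ Set.Ico (-(((n - 1) / 2 : ℕ) : ℤ)) (-(((n - 1) / 2 : ℕ) : ℤ) + n) := by
    rw [modes, Finset.mem_Icc, Set.mem_Ico]
    omega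
  obtain ⟨m, hm, hunique⟩ := existsUnique_add_zsmul_mem_Ico (by omega : (0 : ℤ) < n) j
    (-(((n - 1) / 2 : ℕ) : ℤ))
  refine ⟨j + m • (n : ℤ), ⟨(hmodes _).2 hm, -m, by simp [mul_comm]⟩, fun k ⟨hk, d, hd⟩ => ?_⟩
  have hkd : k = j + (-d) • (n : ℤ) := by
    rw [smul_eq_mul]
    linear_combination -hd
  rw [hkd] at hk ⊢
  rw [hunique (-d) ((hmodes _).1 hk)]

theorem sum_modes_indicator_aliases {M : Type*} [AddCommMonoid M] (hn : n ≠ 0) (a : ℤ → M)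
    (j : ℤ) : ∑ k ∈ modes n, (aliases n k).indicator a j = a j := by
  obtain ⟨k, ⟨hk, hjk⟩, hunique⟩ := existsUnique_mem_modes hn j
  rw [Finset.sum_eq_single_of_mem k hk, Set.indicator_of_mem hjk]
  exact fun l hl hlk => Set.indicator_of_notMem (fun hjl => hlk (hunique l ⟨hl, hjl⟩)) a

theorem sum_discreteCoef {F : ℝ → ℂ} {c : ℤ → ℂ}
    (h : ∀ θ : ℝ, HasSum (fun k : ℤ => c k * Complex.exp (Complex.I * k * θ)) (F θ))
    (hn : n ≠ 0) : ∑ k ∈ modes n, discreteCoef n F k = F 0 := by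
  have hmodes := hasSum_sum fun k (_ : k ∈ modes n) => hasSum_discreteCoef h hn k
  simp only [sum_modes_indicator_aliases hn] at hmodes
  exact hmodes.unique (by simpa using h 0)

/-- The coefficients of the trigonometric interpolant, extended by zero. -/
noncomputable def interpCoef (n : ℕ) (F : ℝ → ℂ) : ℤ → ℂ :=
  (modes n : Set ℤ).indicator (discreteCoef n F)

theorem interpCoef_finite (n : ℕ) (F : ℝ → ℂ) : (interpCoef n F).support.Finite :=
  (modes n).finite_toSet.subset Set.support_indicator_subset

theorem bracket_intCast (k : ℤ) : bracket k = ((1 + k.natAbs : ℕ) : ℝ≥0∞) := by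
  rw [bracket, enorm_eq_nnnorm, ← NNReal.natCast_natAbs]
  push_cast
  rfl

theorem two_mul_natAbs_le_of_mem_modes {k : ℤ} (hk : k ∈ modes n) : 2 * k.natAbs ≤ n := by
  rw [modes, Finset.mem_Icc] at hk
  omega

theorem bracket_le_of_mem_modes (hn : n ≠ 0) {k : ℤ} (hk : k ∈ modes n) : bracket k ≤ 2 * n := by
  have hle := two_mul_natAbs_le_of_mem_modes hk
  rw [bracket_intCast]
  norm_cast
  omega

theorem le_two_mul_bracket_of_notMem_modes {k : ℤ} (hk : k ∉ modes n) : n ≤ 2 * bracket k := by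
  rw [modes, Finset.mem_Icc] at hk
  rw [bracket_intCast]
  norm_cast
  omega

theorem mul_bracket_le_four_mul_bracket {k p : ℤ} (hk : 2 * k.natAbs ≤ n) (hp : p ≠ 0) :
    n * bracket p ≤ 4 * bracket (k + n * p) := by
  have htri : n * p.natAbs ≤ (k + n * p).natAbs + k.natAbs := by
    simpa [Int.natAbs_mul] using Int.natAbs_sub_le (k + n * p) k
  have hp1 := Int.natAbs_pos.2 hp
  simp only [bracket_intCast]
  norm_cast
  nlinarith

theorem rpow_neg_le_rpow_mul_rpow_neg {a x y : ℝ≥0∞} (ha : a ≠ 0) (ha' : a ≠ ⊤) {r : ℝ}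
    (hr : 0 ≤ r) (h : x ≤ a * y) : y ^ (-r) ≤ a ^ r * x ^ (-r) := by
  have har := (ENNReal.rpow_pos_of_nonneg ha.bot_lt hr).ne'
  have har' := ENNReal.rpow_ne_top_of_nonneg hr ha'
  have hpow : x ^ r ≤ a ^ r * y ^ r :=
    (ENNReal.rpow_le_rpow h hr).trans_eq (ENNReal.mul_rpow_of_nonneg _ _ hr)
  calc y ^ (-r) = a ^ r * (a ^ r * y ^ r)⁻¹ := by
        rw [ENNReal.mul_inv (.inl har) (.inl har'), ENNReal.mul_inv_cancel_left har har',
          ENNReal.rpow_neg]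
    _ ≤ a ^ r * x ^ (-r) := by
        rw [ENNReal.rpow_neg]
        gcongr

theorem tsum_aliases_sdiff_bracket_rpow_le {r : ℝ} (hr : 0 ≤ r) (hn : n ≠ 0) {k : ℤ}
    (hk : 2 * k.natAbs ≤ n) :
    ∑' j : ↥(aliases n k \ {k}), bracket (j : ℤ) ^ (-r) ≤
      4 ^ r * (n : ℝ≥0∞) ^ (-r) * ∑' p : ℤ, bracket p ^ (-r) := by
  choose p hp using fun j : ↥(aliases n k \ {k}) => j.2.1
  have hj (j : ↥(aliases n k \ {k})) : (j : ℤ) = k + n * p j := eq_add_of_sub_eq' (hp j)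
  have hinj : Function.Injective p := fun i j hij => Subtype.ext (by rw [hj, hj, hij])
  rw [← ENNReal.tsum_mul_left]
  refine le_trans (ENNReal.tsum_le_tsum fun j => ?_) (ENNReal.tsum_comp_le_tsum_of_injective hinj _)
  have hp0 : p j ≠ 0 := fun h => j.2.2 (by simpa [h] using hj j)
  rw [hj, mul_assoc, ← ENNReal.mul_rpow_of_ne_zero (by exact_mod_cast hn) (bracket_ne_zero _)]
  exact rpow_neg_le_rpow_mul_rpow_neg (by norm_num) (by norm_num) hr
    (mul_bracket_le_four_mul_bracket hk hp0)

theorem enorm_discreteCoef_sub_sq_le {F : ℝ → ℂ} {c : ℤ → ℂ}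
    (h : ∀ θ : ℝ, HasSum (fun k : ℤ => c k * Complex.exp (Complex.I * k * θ)) (F θ)) {s : ℝ}
    (hs : 0 ≤ s) (hn : n ≠ 0) {k : ℤ} (hk : 2 * k.natAbs ≤ n) :
    ‖discreteCoef n F k - c k‖ₑ ^ 2 ≤
      4 ^ (2 * s) * (n : ℝ≥0∞) ^ (-(2 * s)) * (∑' p : ℤ, bracket p ^ (-(2 * s))) *
        ∑' j, (aliases n k).indicator (fun j => bracket j ^ (2 * s) * ‖c j‖ₑ ^ 2) j := by
  have hsum : HasSum (fun j : ↥(aliases n k \ {k}) => c j) (discreteCoef n F k - c k) := by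
    refine (hasSum_subtype_iff_indicator (f := c)).2 ?_
    refine ((hasSum_discreteCoef h hn k).sub (hasSum_pi_single k (c k))).congr_fun fun j => ?_
    rcases eq_or_ne j k with rfl | hjk
    · simp [aliases]
    · by_cases hj : j ∈ aliases n k <;> simp [Set.indicator, hj, hjk]
  calc ‖discreteCoef n F k - c k‖ₑ ^ 2
      ≤ (∑' j : ↥(aliases n k \ {k}),
          bracket (j : ℤ) ^ (-s) * (bracket (j : ℤ) ^ s * ‖c j‖ₑ)) ^ 2 := by
        rw [← hsum.tsum_eq]
        gcongr
        refine enorm_tsum_le_tsum_enorm.trans_eq (tsum_congr fun j => ?_)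
        rw [← mul_assoc, ← bracket_rpow_add, neg_add_cancel, ENNReal.rpow_zero, one_mul]
    _ ≤ (∑' j : ↥(aliases n k \ {k}), bracket (j : ℤ) ^ (-(2 * s))) *
          ∑' j : ↥(aliases n k \ {k}), bracket (j : ℤ) ^ (2 * s) * ‖c j‖ₑ ^ 2 := by
        refine (tsum_mul_sq_le _ _).trans_eq ?_
        simp only [mul_pow, bracket_rpow_sq, mul_neg]
    _ ≤ _ := by
        rw [← tsum_subtype (aliases n k)]
        gcongr
        · exact tsum_aliases_sdiff_bracket_rpow_le (by positivity) hn hk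
        · exact ENNReal.tsum_mono_subtype (fun j => bracket j ^ (2 * s) * ‖c j‖ₑ ^ 2)
            Set.sdiff_subset

theorem bracket_rpow_le_of_notMem_modes {σ s : ℝ} (hσs : σ ≤ s) {k : ℤ} (hk : k ∉ modes n) :
    bracket k ^ (2 * σ) ≤
      2 ^ (2 * (s - σ)) * (n : ℝ≥0∞) ^ (2 * (σ - s)) * bracket k ^ (2 * s) := by
  rw [show 2 * σ = -(2 * (s - σ)) + 2 * s by ring, bracket_rpow_add,
    show 2 * (σ - s) = -(2 * (s - σ)) by ring]
  gcongr ?_ * _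
  exact rpow_neg_le_rpow_mul_rpow_neg two_ne_zero ENNReal.ofNat_ne_top (by linarith)
    (le_two_mul_bracket_of_notMem_modes hk)

/-- The constant of the interpolation error estimate from `H^s(𝕋)` to `H^σ(𝕋)`. The two summands
account for the aliasing into the modes and for the truncation to the modes. -/
noncomputable def interpConst (σ s : ℝ) : ℝ≥0∞ :=
  2 ^ (2 * σ) * 4 ^ (2 * s) * (∑' p : ℤ, bracket p ^ (-(2 * s))) + 2 ^ (2 * (s - σ))

theorem interpConst_ne_top (σ : ℝ) {s : ℝ} (hs : 1 / 2 < s) : interpConst σ s ≠ ⊤ := by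
  have := tsum_bracket_rpow_ne_top (r := 2 * s) (by linarith)
  unfold interpConst
  finiteness

theorem bracket_rpow_mul_enorm_discreteCoef_sub_sq_le {F : ℝ → ℂ} {c : ℤ → ℂ}
    (h : ∀ θ : ℝ, HasSum (fun k : ℤ => c k * Complex.exp (Complex.I * k * θ)) (F θ)) {σ s : ℝ}
    (hσ : 0 ≤ σ) (hs : 0 ≤ s) (hn : n ≠ 0) {k : ℤ} (hk : k ∈ modes n) :
    bracket k ^ (2 * σ) * ‖discreteCoef n F k - c k‖ₑ ^ 2 ≤
      2 ^ (2 * σ) * 4 ^ (2 * s) * (∑' p : ℤ, bracket p ^ (-(2 * s))) *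
        (n : ℝ≥0∞) ^ (2 * (σ - s)) *
        ∑' j, (aliases n k).indicator (fun j => bracket j ^ (2 * s) * ‖c j‖ₑ ^ 2) j := by
  have hn' : (n : ℝ≥0∞) ≠ 0 := by exact_mod_cast hn
  have hpow : bracket k ^ (2 * σ) ≤ 2 ^ (2 * σ) * (n : ℝ≥0∞) ^ (2 * σ) :=
    (ENNReal.rpow_le_rpow (bracket_le_of_mem_modes hn hk) (by positivity)).trans_eq
      (ENNReal.mul_rpow_of_nonneg _ _ (by positivity))
  refine (mul_le_mul' hpow (enorm_discreteCoef_sub_sq_le h hs hn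
    (two_mul_natAbs_le_of_mem_modes hk))).trans_eq ?_
  rw [mul_sub, sub_eq_add_neg, ENNReal.rpow_add _ _ hn' (by finiteness)]
  ring

theorem tsum_indicator_modes_tsum_aliases (hn : n ≠ 0) (a : ℤ → ℝ≥0∞) :
    ∑' k, (modes n : Set ℤ).indicator (fun k => ∑' j, (aliases n k).indicator a j) k =
      ∑' j, a j := by
  rw [tsum_eq_sum fun k hk => Set.indicator_of_notMem hk _,
    Finset.sum_congr rfl fun k hk => Set.indicator_of_mem hk _,
    ← Summable.tsum_finsetSum fun k _ => ENNReal.summable]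
  simp only [sum_modes_indicator_aliases hn]

theorem weightedSq_interpCoef_sub_le {F : ℝ → ℂ} {c : ℤ → ℂ}
    (h : ∀ θ : ℝ, HasSum (fun k : ℤ => c k * Complex.exp (Complex.I * k * θ)) (F θ)) {σ s : ℝ}
    (hσ : 0 ≤ σ) (hσs : σ ≤ s) (hn : n ≠ 0) :
    weightedSq σ (interpCoef n F - c) ≤
      interpConst σ s * (n : ℝ≥0∞) ^ (2 * (σ - s)) * weightedSq s c := by
  set a : ℤ → ℝ≥0∞ := fun j => bracket j ^ (2 * s) * ‖c j‖ₑ ^ 2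
  set Z := ∑' p : ℤ, bracket p ^ (-(2 * s))
  set A := 2 ^ (2 * σ) * 4 ^ (2 * s) * Z * (n : ℝ≥0∞) ^ (2 * (σ - s))
  set B := 2 ^ (2 * (s - σ)) * (n : ℝ≥0∞) ^ (2 * (σ - s))
  have pointwise (k : ℤ) : bracket k ^ (2 * σ) * ‖(interpCoef n F - c) k‖ₑ ^ 2 ≤
      (modes n : Set ℤ).indicator (fun k => A * ∑' j, (aliases n k).indicator a j) k + B * a k := by
    rw [Pi.sub_apply, interpCoef]
    by_cases hk : k ∈ modes n
    · simpa [hk] using le_add_of_le_of_nonneg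
        (bracket_rpow_mul_enorm_discreteCoef_sub_sq_le h hσ (hσ.trans hσs) hn hk) zero_le
    · have := bracket_rpow_le_of_notMem_modes hσs hk
      simp only [Finset.mem_coe, hk, not_false_eq_true, Set.indicator_of_notMem, zero_sub,
        enorm_neg, zero_add, a, B, ← mul_assoc]
      gcongr
  calc weightedSq σ (interpCoef n F - c)
      ≤ ∑' k, ((modes n : Set ℤ).indicator (fun k => A * ∑' j, (aliases n k).indicator a j) k +
          B * a k) := ENNReal.tsum_le_tsum pointwise
    _ = A * weightedSq s c + B * weightedSq s c := by
        simp only [Set.indicator_const_mul, ENNReal.tsum_add, ENNReal.tsum_mul_left,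
          tsum_indicator_modes_tsum_aliases hn]
        rfl
    _ = _ := by
        simp only [A, B, Z, interpConst]
        ring

end

/-! ### The rational interpolation error -/

theorem rationalInterp_eq_mobiusSeries {β : ℝ} {f : ℝ → ℂ} {c : ℤ → ℂ}
    (h : ∀ θ : ℝ, HasSum (fun k : ℤ => c k * Complex.exp (Complex.I * k * θ)) (pullback β f θ))
    {n : ℕ} (hn : n ≠ 0) :
    rationalInterp β n f = mobiusSeries β (interpCoef n (pullback β f)) := by
  have hzero := (sum_discreteCoef h hn).trans (pullback_zero β f)
  funext x
  rw [mobiusSeries, tsum_eq_sum (s := modes n) fun k hk => by simp [interpCoef, hk],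
    rationalInterp, ← sub_zero (∑ k ∈ modes n, _), ← hzero, ← Finset.sum_sub_distrib]
  refine Finset.sum_congr rfl fun k hk => ?_
  rw [interpCoef, Set.indicator_of_mem (Finset.mem_coe.2 hk), mul_sub, mul_one]

theorem weightedSq_fourierCoef {s : ℝ} {F : ℝ → ℂ} (hF : MemSobolevT s F) :
    weightedSq s (fourierCoef F) = ENNReal.ofReal (sobolevNormT s F) ^ 2 := by
  have hnonneg (k : ℤ) : 0 ≤ sobolevTerm s F k := by
    unfold sobolevTerm
    positivity
  rw [sobolevNormT, ← ENNReal.ofReal_pow (Real.sqrt_nonneg _), Real.sq_sqrt (tsum_nonneg hnonneg),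
    ENNReal.ofReal_tsum_of_nonneg hnonneg hF.2, weightedSq]
  refine tsum_congr fun k => ?_
  rw [sobolevTerm, ENNReal.ofReal_mul (by positivity), ENNReal.ofReal_pow (norm_nonneg _),
    ofReal_norm, ← ofReal_one_add_norm_rpow, Int.norm_eq_abs]

theorem weightedSq_fourierCoef_ne_top {s : ℝ} {F : ℝ → ℂ} (hF : MemSobolevT s F) :
    weightedSq s (fourierCoef F) ≠ ⊤ := by
  rw [weightedSq_fourierCoef hF]
  finiteness

theorem natCast_rpow_mul_ofReal_sq {n : ℕ} (hn : n ≠ 0) (p N : ℝ) :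
    (n : ℝ≥0∞) ^ (2 * p) * ENNReal.ofReal N ^ 2 = ENNReal.ofReal ((n : ℝ) ^ p * N) ^ 2 := by
  rw [ENNReal.ofReal_mul (by positivity), ← ENNReal.ofReal_rpow_of_pos (by positivity),
    ENNReal.ofReal_natCast, mul_pow, ← ENNReal.rpow_mul_natCast, mul_comm p]
  norm_cast

theorem le_ofReal_sqrt_add {x P Q : ℝ≥0∞} {a b : ℝ} (hP : P ≠ ⊤) (hQ : Q ≠ ⊤) (ha : 0 ≤ a)
    (hb : 0 ≤ b) (h : x ^ 2 ≤ P * ENNReal.ofReal a ^ 2 + Q * ENNReal.ofReal b ^ 2) :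
    x ≤ ENNReal.ofReal (√P.toReal * a + √Q.toReal * b) := by
  have sqrt_mul_sq {P : ℝ≥0∞} (hP : P ≠ ⊤) (a : ℝ) :
      P * ENNReal.ofReal a ^ 2 = ENNReal.ofReal (√P.toReal * a) ^ 2 := by
    rw [ENNReal.ofReal_mul (Real.sqrt_nonneg _), mul_pow, ← ENNReal.ofReal_pow (Real.sqrt_nonneg _),
      Real.sq_sqrt ENNReal.toReal_nonneg, ENNReal.ofReal_toReal hP]
  rw [sqrt_mul_sq hP, sqrt_mul_sq hQ] at h
  rw [ENNReal.ofReal_add (by positivity) (by positivity)]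
  exact (ENNReal.pow_le_pow_left_iff two_ne_zero).1
    (h.trans (pow_add_pow_le zero_le zero_le two_ne_zero))

section

variable {β s : ℝ} (hβ : 0 < β) (hs : 1 / 2 < s) {f : ℝ → ℂ} (hf : Continuous f)
  (hf0 : Tendsto f (cocompact ℝ) (𝓝 0)) (hF : MemSobolevT s (pullback β f))

include hβ hs hf hf0 hF

theorem hasSum_fourierCoef_pullback (θ : ℝ) :
    HasSum (fun k : ℤ => fourierCoef (pullback β f) k * Complex.exp (Complex.I * k * θ))
      (pullback β f θ) :=
  hasSum_fourierCoef (pullback_continuous hβ hf hf0) (pullback_periodic β f)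
    (summable_norm_of_weightedSq hs (weightedSq_fourierCoef_ne_top hF)) θ

theorem mobiusSeries_fourierCoef_pullback : mobiusSeries β (fourierCoef (pullback β f)) = f :=
  mobiusSeries_eq_of_hasSum hβ (hasSum_fourierCoef_pullback hβ hs hf hf0 hF)

variable {n : ℕ} (hn : n ≠ 0)

include hn

theorem mobiusSeries_interpCoef_pullback :
    mobiusSeries β (interpCoef n (pullback β f)) = rationalInterp β n f :=
  (rationalInterp_eq_mobiusSeries (hasSum_fourierCoef_pullback hβ hs hf hf0 hF) hn).symm

theorem mobiusSeries_interpCoef_sub_fourierCoef :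
    mobiusSeries β (interpCoef n (pullback β f) - fourierCoef (pullback β f)) =
      fun x => rationalInterp β n f x - f x := by
  funext x
  rw [mobiusSeries_sub hβ (summable_norm_of_finite (interpCoef_finite n _))
    (summable_norm_of_weightedSq hs (weightedSq_fourierCoef_ne_top hF)),
    mobiusSeries_interpCoef_pullback hβ hs hf hf0 hF hn,
    mobiusSeries_fourierCoef_pullback hβ hs hf hf0 hF]

theorem weightedSq_interpCoef_sub_fourierCoef_le {σ : ℝ} (hσ : 0 ≤ σ) (hσs : σ ≤ s) :
    weightedSq σ (interpCoef n (pullback β f) - fourierCoef (pullback β f)) ≤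
      interpConst σ s * ENNReal.ofReal ((n : ℝ) ^ (σ - s) * sobolevNormT s (pullback β f)) ^ 2 := by
  rw [← natCast_rpow_mul_ofReal_sq hn, ← weightedSq_fourierCoef hF, ← mul_assoc]
  exact weightedSq_interpCoef_sub_le (hasSum_fourierCoef_pullback hβ hs hf hf0 hF) hσ hσs hn

theorem weightedSq_interpCoef_sub_fourierCoef_ne_top :
    weightedSq s (interpCoef n (pullback β f) - fourierCoef (pullback β f)) ≠ ⊤ := by
  have := interpConst_ne_top s hs
  exact ne_top_of_le_ne_top (by finiteness)
    (weightedSq_interpCoef_sub_fourierCoef_le hβ hs hf hf0 hF hn (by linarith) le_rfl)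

theorem exists_hasPVFourier_interp_sub_le {σ ξ : ℝ} (hσ : 0 ≤ σ) (hσs : σ ≤ s) {w : ℝ}
    (hw : 0 ≤ w) {C : ℝ≥0∞} (hC : C ≠ ⊤)
    (h : ∀ c, weightedSq σ c ≠ ⊤ → ∃ a, HasPVFourier (mobiusSeries β c) ξ a ∧
      (ENNReal.ofReal w * ‖a‖ₑ) ^ 2 ≤ C * weightedSq σ c) :
    ∃ a b, HasPVFourier (rationalInterp β n f) ξ a ∧ HasPVFourier f ξ b ∧
      w * ‖a - b‖ ≤ √(C * interpConst σ s).toReal *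
        ((n : ℝ) ^ (σ - s) * sobolevNormT s (pullback β f)) := by
  have hconst := interpConst_ne_top σ hs
  have hN : 0 ≤ sobolevNormT s (pullback β f) := Real.sqrt_nonneg _
  have lower {c} (hc : weightedSq s c ≠ ⊤) : weightedSq σ c ≠ ⊤ :=
    ne_top_of_le_ne_top hc (weightedSq_mono_exponent hσs c)
  obtain ⟨a, ha, -⟩ := h _ (weightedSq_ne_top_of_finite σ (interpCoef_finite n (pullback β f)))
  obtain ⟨b, hb, -⟩ := h _ (lower (weightedSq_fourierCoef_ne_top hF))
  obtain ⟨d, hd, hdle⟩ := h _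
    (lower (weightedSq_interpCoef_sub_fourierCoef_ne_top hβ hs hf hf0 hF hn))
  have hR := mobiusSeries_continuous hβ
    (summable_norm_of_finite (interpCoef_finite n (pullback β f)))
  rw [mobiusSeries_interpCoef_pullback hβ hs hf hf0 hF hn] at ha hR
  rw [mobiusSeries_fourierCoef_pullback hβ hs hf hf0 hF] at hb
  rw [mobiusSeries_interpCoef_sub_fourierCoef hβ hs hf hf0 hF hn] at hd
  refine ⟨a, b, ha, hb, ?_⟩
  rw [(ha.sub hR hf hb).unique hd]
  have hle : ENNReal.ofReal (w * ‖d‖) ≤ ENNReal.ofReal (√(C * interpConst σ s).toReal *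
      ((n : ℝ) ^ (σ - s) * sobolevNormT s (pullback β f)) + √(0 : ℝ≥0∞).toReal * 0) := by
    refine le_ofReal_sqrt_add (by finiteness) (by simp) (by positivity) le_rfl ?_
    rw [ENNReal.ofReal_mul hw, ofReal_norm, zero_mul, add_zero, mul_assoc]
    refine hdle.trans ?_
    gcongr
    exact weightedSq_interpCoef_sub_fourierCoef_le hβ hs hf hf0 hF hn hσ hσs
  rw [mul_zero, add_zero] at hle
  exact (ENNReal.ofReal_le_ofReal_iff (by positivity)).1 hle

end

theorem uniform_convergence {β : ℝ} (hβ : 0 < β) {ε s : ℝ} (hε : 0 < ε) (hs : 3 / 2 + ε < s) :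
    ∃ C : ℝ, ∀ f : ℝ → ℂ, Continuous f → Tendsto f (cocompact ℝ) (𝓝 0) →
      MemSobolevT s (pullback β f) → ∀ n : ℕ, 1 ≤ n → ∀ k : ℝ, ∃ a b : ℂ,
        HasPVFourier (rationalInterp β n f) k a ∧ HasPVFourier f k b ∧
        ‖a - b‖ ≤ C * (n : ℝ) ^ (3 / 2 + ε - s) * sobolevNormT s (pullback β f) := by
  obtain ⟨C, hC, h⟩ := exists_hasPVFourier_le_weightedSq hβ (by linarith : 3 / 2 < 3 / 2 + ε)
  refine ⟨√(C * interpConst (3 / 2 + ε) s).toReal, fun f hf hf0 hF n hn k => ?_⟩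
  simpa only [one_mul, mul_assoc] using
    exists_hasPVFourier_interp_sub_le hβ (by linarith) hf hf0 hF (Nat.one_le_iff_ne_zero.1 hn)
      (by linarith) hs.le zero_le_one hC (by simpa using fun c hc => h c hc k)

theorem asymptotic_approximation {β : ℝ} (hβ : 0 < β) {j : ℕ} {s : ℝ} (hj : 0 < j)
    (hs : (j : ℝ) ≤ s) :
    ∃ C : ℝ, ∀ f : ℝ → ℂ, Continuous f → Tendsto f (cocompact ℝ) (𝓝 0) →
      MemSobolevT s (pullback β f) → ∀ n : ℕ, 1 ≤ n → ∀ k : ℝ, k ≠ 0 → ∃ a b : ℂ,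
        HasPVFourier (rationalInterp β n f) k a ∧ HasPVFourier f k b ∧
        ‖a - b‖ ≤ C * (|k| ^ j)⁻¹ * (n : ℝ) ^ ((j : ℝ) - s) * sobolevNormT s (pullback β f) := by
  obtain ⟨i, rfl⟩ := Nat.exists_eq_add_one_of_ne_zero hj.ne'
  push_cast at hs ⊢
  obtain ⟨C, hC, h⟩ := exists_hasPVFourier_sq_le hβ i
  refine ⟨√(C * interpConst (i + 1) s).toReal, fun f hf hf0 hF n hn k hk => ?_⟩
  obtain ⟨a, b, ha, hb, hab⟩ := exists_hasPVFourier_interp_sub_le hβ (by linarith) hf hf0 hF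
    (Nat.one_le_iff_ne_zero.1 hn) (by positivity) hs (pow_nonneg (abs_nonneg k) (i + 1)) hC
    fun c hc => by
      simpa only [mul_pow, ENNReal.ofReal_pow (abs_nonneg k), ← Real.enorm_eq_ofReal_abs, ← pow_mul,
        mul_comm (i + 1)] using h c hc k hk
  refine ⟨a, b, ha, hb, ?_⟩
  rw [mul_comm, ← le_div_iff₀ (by positivity)] at hab
  refine hab.trans_eq ?_
  ring

theorem exists_sobolevNormR_interp_sub_le_of_one_le {β : ℝ} (hβ : 0 < β) :
    ∃ C₁ C₂ : ℝ → ℝ → ℝ, (∀ s t, 0 ≤ C₂ s t) ∧ ∀ ε s t : ℝ, 0 < ε → 1 + ε < s → 1 ≤ t → t ≤ s →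
      ∀ f : ℝ → ℂ, Continuous f → Tendsto f (cocompact ℝ) (𝓝 0) →
        MemSobolevT s (pullback β f) → ∀ n : ℕ, n ≠ 0 →
          sobolevNormR t (fun x => rationalInterp β n f x - f x) ≤
            ENNReal.ofReal ((C₁ ε s * (n : ℝ) ^ (1 + ε - s) + C₂ s t * (n : ℝ) ^ (t - s)) *
              sobolevNormT s (pullback β f)) := by
  choose A hA h using exists_sobolevNormR_sq_le hβ
  choose! B hB hAB using h
  set Z : ℝ → ℝ≥0∞ := fun ε => ∑' k : ℤ, bracket k ^ (-(2 * (1 + ε - 1 / 2)))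
  refine ⟨fun ε s => √(A s * Z ε * interpConst (1 + ε) s).toReal,
    fun s t => √(B s t * interpConst t s).toReal, fun _ _ => Real.sqrt_nonneg _,
    fun ε s t hε hs ht hts f hf hf0 hF n hn => ?_⟩
  have hs' : 1 / 2 < s := by linarith
  have hA' := hA s
  have hB' := hB s t ht hts
  have hZ : Z ε ≠ ⊤ := tsum_bracket_rpow_ne_top (by linarith)
  have hI₁ := interpConst_ne_top (1 + ε) hs'
  have hI₂ := interpConst_ne_top t hs'
  have hN : 0 ≤ sobolevNormT s (pullback β f) := Real.sqrt_nonneg _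
  set e := interpCoef n (pullback β f) - fourierCoef (pullback β f)
  have he {σ : ℝ} (hσ : 0 ≤ σ) (hσs : σ ≤ s) :=
    weightedSq_interpCoef_sub_fourierCoef_le hβ hs' hf hf0 hF hn hσ hσs
  have hmoment : absMoment (1 / 2) e ≠ ⊤ := absMoment_ne_top (by linarith)
    (weightedSq_interpCoef_sub_fourierCoef_ne_top hβ hs' hf hf0 hF hn)
  rw [← mobiusSeries_interpCoef_sub_fourierCoef hβ hs' hf hf0 hF hn, add_mul, mul_assoc, mul_assoc]
  refine le_ofReal_sqrt_add (by finiteness) (by finiteness) (by positivity) (by positivity) ?_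
  calc sobolevNormR t (mobiusSeries β e) ^ 2
      ≤ A s * absMoment (1 / 2) e ^ 2 + B s t * weightedSq t e := hAB s t ht hts e hmoment
    _ ≤ A s * (Z ε * weightedSq (1 + ε) e) + B s t * weightedSq t e := by
        gcongr
        exact absMoment_sq_le (1 / 2) (1 + ε) e
    _ ≤ _ := by
        simp only [mul_assoc]
        gcongr
        · exact he (by linarith) hs.le
        · exact he (by linarith) hts

theorem weighted_l2_convergence {β : ℝ} (hβ : 0 < β) :
    ∃ C₁ C₂ : ℝ → ℝ → ℝ, ∀ ε s t : ℝ, 0 < ε → 1 + ε < s → t ≤ s →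
      ∀ f : ℝ → ℂ, Continuous f → Tendsto f (cocompact ℝ) (𝓝 0) →
        MemSobolevT s (pullback β f) →
        MemLp f 2 (volume : Measure ℝ) ∧
        ∀ n : ℕ, 1 ≤ n →
          MemLp (rationalInterp β n f) 2 (volume : Measure ℝ) ∧
          sobolevNormR t (fun x => rationalInterp β n f x - f x) ≤
            ENNReal.ofReal ((C₁ ε s * (n : ℝ) ^ (1 + ε - s) + C₂ s t * (n : ℝ) ^ (t - s)) *
              sobolevNormT s (pullback β f)) := by
  obtain ⟨C₁, C₂, hC₂, h⟩ := exists_sobolevNormR_interp_sub_le_of_one_le hβ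
  refine ⟨fun ε s => C₁ ε s + C₂ s 1, C₂, fun ε s t hε hs hts f hf hf0 hF => ?_⟩
  have hs' : 1 / 2 < s := by linarith
  have hmem := memLp_mobiusSeries hβ (absMoment_ne_top (p := 1 / 2) (by linarith)
    (weightedSq_fourierCoef_ne_top hF))
  rw [mobiusSeries_fourierCoef_pullback hβ hs' hf hf0 hF] at hmem
  refine ⟨hmem, fun n hn => ?_⟩
  have hn0 := Nat.one_le_iff_ne_zero.1 hn
  have hn1 : (1 : ℝ) ≤ n := by exact_mod_cast hn
  have hmem_n := memLp_mobiusSeries_of_finite hβ (interpCoef_finite n (pullback β f))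
  rw [mobiusSeries_interpCoef_pullback hβ hs' hf hf0 hF hn0] at hmem_n
  have hN : 0 ≤ sobolevNormT s (pullback β f) := Real.sqrt_nonneg _
  have hC₂1 := hC₂ s 1
  have hC₂t := hC₂ s t
  refine ⟨hmem_n, ?_⟩
  rcases le_total t 1 with ht | ht
  · refine (sobolevNormR_mono ht _).trans
      ((h ε s 1 hε hs le_rfl (by linarith) f hf hf0 hF n hn0).trans ?_)
    have hexp : (n : ℝ) ^ (1 - s) ≤ (n : ℝ) ^ (1 + ε - s) :=
      Real.rpow_le_rpow_of_exponent_le hn1 (by linarith)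
    have hbound : C₁ ε s * (n : ℝ) ^ (1 + ε - s) + C₂ s 1 * (n : ℝ) ^ (1 - s) ≤
        (C₁ ε s + C₂ s 1) * (n : ℝ) ^ (1 + ε - s) + C₂ s t * (n : ℝ) ^ (t - s) := by
      rw [add_mul]
      exact le_add_of_le_of_nonneg (by gcongr) (by positivity)
    exact ENNReal.ofReal_le_ofReal (mul_le_mul_of_nonneg_right hbound hN)
  · refine (h ε s t hε hs ht hts f hf hf0 hF n hn0).trans ?_
    gcongr ENNReal.ofReal ((?_ * _ + _) * _)
    exact le_add_of_nonneg_right hC₂1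

end RationalFourier

theorem mainTheorem3 (β : ℝ) (hβ : 0 < β) :
    -- weighted square-integrable convergence
    (∃ C₁ C₂ : ℝ → ℝ → ℝ, ∀ ε s t : ℝ, 0 < ε → 1 + ε < s → t ≤ s →
      ∀ f : ℝ → ℂ, Continuous f → Tendsto f (cocompact ℝ) (𝓝 0) →
        RationalFourier.MemSobolevT s (RationalFourier.pullback β f) →
        MemLp f 2 (volume : Measure ℝ) ∧
        ∀ n : ℕ, 1 ≤ n →
          MemLp (RationalFourier.rationalInterp β n f) 2 (volume : Measure ℝ) ∧
          RationalFourier.sobolevNormR t (fun x => RationalFourier.rationalInterp β n f x - f x) ≤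
            ENNReal.ofReal ((C₁ ε s * (n : ℝ) ^ (1 + ε - s) + C₂ s t * (n : ℝ) ^ (t - s)) *
              RationalFourier.sobolevNormT s (RationalFourier.pullback β f))) ∧
    -- uniform convergence
    (∀ ε s : ℝ, 0 < ε → 3 / 2 + ε < s → ∃ C : ℝ,
      ∀ f : ℝ → ℂ, Continuous f → Tendsto f (cocompact ℝ) (𝓝 0) →
        RationalFourier.MemSobolevT s (RationalFourier.pullback β f) →
        ∀ n : ℕ, 1 ≤ n → ∀ k : ℝ, ∃ a b : ℂ,
          RationalFourier.HasPVFourier (RationalFourier.rationalInterp β n f) k a ∧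
          RationalFourier.HasPVFourier f k b ∧
          ‖a - b‖ ≤ C * (n : ℝ) ^ (3 / 2 + ε - s) *
            RationalFourier.sobolevNormT s (RationalFourier.pullback β f)) ∧
    -- asymptotic approximation
    (∀ (j : ℕ) (s : ℝ), 0 < j → (j : ℝ) ≤ s → ∃ C : ℝ,
      ∀ f : ℝ → ℂ, Continuous f → Tendsto f (cocompact ℝ) (𝓝 0) →
        RationalFourier.MemSobolevT s (RationalFourier.pullback β f) →
        ∀ n : ℕ, 1 ≤ n → ∀ k : ℝ, k ≠ 0 → ∃ a b : ℂ,
          RationalFourier.HasPVFourier (RationalFourier.rationalInterp β n f) k a ∧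
          RationalFourier.HasPVFourier f k b ∧
          ‖a - b‖ ≤ C * (|k| ^ j)⁻¹ * (n : ℝ) ^ ((j : ℝ) - s) *
            RationalFourier.sobolevNormT s (RationalFourier.pullback β f)) :=
  ⟨RationalFourier.weighted_l2_convergence hβ,
    fun _ _ hε hs => RationalFourier.uniform_convergence hβ hε hs,
    fun _ _ hj hs => RationalFourier.asymptotic_approximation hβ hj hs⟩
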